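/- Let $d\ge 2$, let $B(x,r)$ denote the closed Euclidean ball in $\mathbb R^d$ with centre $x$ and radius $r$, let $m_d$ be Lebesgue measure on $\mathbb R^d$, let $\omega_k$ be the volume of the unit ball of $\mathbb R^k$, and let $$\mathcal H^{d-1}(E)=\lim_{\varepsilon\to0^+}\inf\Bigl\{\omega_{d-1}\sum_j r_j^{d-1}: E\subset\bigcup_j B(x_j,r_j),\ 0<r_j\le\varepsilon\Bigr\}$$ (infimum over countable families of balls) be the normalized $(d-1)$-dimensional Hausdorff measure. For $\Gamma\subset\mathbb R^d$ put $$\mathbf D^-(\Gamma)=\liminf_{r\to\infty}\ \inf_{x\in\mathbb R^d}\frac{\mathcal H^{d-1}(\Gamma\cap B(x,r))}{m_d(B(x,r))}.$$ For a function $\varphi:[0,1)\to[0,\infty)$ continuous at $0$, a set $\Gamma\subset\mathbb R^d$ is called $\varphi$-regular if it is closed and $\mathcal H^{d-1}(\Gamma\cap B(x,r))\le\varphi(r)\,\omega_{d-1}r^{d-1}$ for all $x\in\mathbb R^d$ and $r\in(0,1)$. Theorem. For every $\delta>0$ there are a bounded continuous function $f:\mathbb R^d\to\mathbb C$ with $f(0)=\|f\|_{\infty}=1$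 whose distributional Fourier transform $\widehat f$ satisfies $\operatorname{supp}\widehat f\subset B(0,1)$ (with the normalization $\widehat f(\xi)=\int f(x)e^{2\pi i\langle x,\xi\rangle}\,dm_d(x)$), a function $\varphi:[0,1)\to[0,\infty)$ continuous at $0$ with $\varphi(0)=1$, and a $\varphi$-regular set $\Gamma\subset\{x\in\mathbb R^d: f(x)=0\}$ such that $$\mathbf D^-(\Gamma)>2\Bigl(\frac d2\,\frac{\omega_d}{\omega_{d-1}}-\delta\Bigr).$$ -/

import Mathlib

open MeasureTheory Filter Set Metric
open scoped ENNReal SchwartzMap FourierTransform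

noncomputable section

/-- The volume `ω_k` of the unit ball of `ℝ^k`. -/
def unitBallVolume (k : ℕ) : ℝ :=
  (volume (closedBall (0 : EuclideanSpace ℝ (Fin k)) 1)).toReal

/-- `inf {ω_k ∑ r_j ^ k : E ⊆ ⋃ B(x_j, r_j), r_j ≤ ε}`, over countable families of balls
`B(x_j, r_j)`, a family being given by the set `t` of the pairs `(x_j, r_j)`. -/
def hausdorffPremeasure {d : ℕ} (k : ℕ) (ε : ℝ) (E : Set (EuclideanSpace ℝ (Fin d))) : ℝ≥0∞ :=
  ⨅ (t : Set (EuclideanSpace ℝ (Fin d) × ℝ)) (_ : t.Countable)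
    (_ : ∀ p ∈ t, 0 < p.2 ∧ p.2 ≤ ε) (_ : E ⊆ ⋃ p ∈ t, closedBall p.1 p.2),
    ENNReal.ofReal (unitBallVolume k) * ∑' p : t, ENNReal.ofReal p.1.2 ^ k

/-- The `k`-dimensional (spherical) Hausdorff measure in `ℝ^d`, normalized so that it is Lebesgue
measure on `k`-planes: the limit of `hausdorffPremeasure k ε E` as `ε → 0+`, which is a supremum
because that quantity increases as `ε` decreases. -/
def hausdorffSurfaceMeasure {d : ℕ} (k : ℕ) (E : Set (EuclideanSpace ℝ (Fin d))) : ℝ≥0∞ :=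
  ⨆ (ε : ℝ) (_ : 0 < ε), hausdorffPremeasure k ε E

/-- The lower surface density
`D⁻(Γ) = liminf_{r → ∞} inf_x H^{d-1}(Γ ∩ B(x, r)) / m_d(B(x, r))`. -/
def lowerSurfaceDensity {d : ℕ} (Γ : Set (EuclideanSpace ℝ (Fin d))) : ℝ≥0∞ :=
  liminf (fun r : ℝ => ⨅ x : EuclideanSpace ℝ (Fin d),
    hausdorffSurfaceMeasure (d - 1) (Γ ∩ closedBall x r) / volume (closedBall x r)) atTop

/-- `Γ ⊆ ℝ^d` is a `φ`-regular set: `φ : [0, 1) → [0, ∞)` is continuous at `0` (the values of `φ`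
outside `[0, 1)` play no role), `Γ` is closed, and the restriction of `H^{d-1}` to `Γ` gives
every ball `B(x, r)` with `0 < r < 1` a mass of at most `φ(r) ω_{d-1} r^{d-1}`. -/
structure IsPhiRegular {d : ℕ} (φ : ℝ → ℝ) (Γ : Set (EuclideanSpace ℝ (Fin d))) : Prop where
  nonneg : ∀ r ∈ Ico (0 : ℝ) 1, 0 ≤ φ r
  continuousAt_zero : ContinuousWithinAt φ (Ico 0 1) 0
  isClosed : IsClosed Γ
  mass_le : ∀ (x : EuclideanSpace ℝ (Fin d)), ∀ r ∈ Ioo (0 : ℝ) 1,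
    hausdorffSurfaceMeasure (d - 1) (closedBall x r ∩ Γ) ≤
      ENNReal.ofReal (φ r * unitBallVolume (d - 1) * r ^ (d - 1))

/-- `f ∈ PW_∞(K)`: `f` is in `L^∞(ℝ^d)` and the distributional Fourier transform of the tempered
distribution that it defines is supported in `K`. -/
def MemPaleyWienerInfty {d : ℕ} (K : Set (EuclideanSpace ℝ (Fin d)))
    (f : EuclideanSpace ℝ (Fin d) → ℂ) : Prop :=
  ∃ hf : MemLp f ∞ volume,
    Distribution.dsupport
      (𝓕 (Lp.toTemperedDistribution (hf.toLp f)) : 𝓢'(EuclideanSpace ℝ (Fin d), ℂ)) ⊆ K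

end

/-! Take `f x = ∏ cos 2π⟨x, w⟩` over a finite set `s` of vectors. Its frequencies are the sums `∑
±w`, which lie in the zonotope `∑ [-w, w]`. This zonotope is inside the unit ball exactly when its
support function satisfies `∑ |⟨u, w⟩| ≤ ‖u‖`. Each factor vanishes on parallel hyperplanes at
spacing `1 / (2‖w‖)`, which have surface density `2‖w‖`, so the zeros of `f` have density `2 ∑ ‖w‖`.

To make `∑ ‖w‖` large, the vectors imitate the rotation-invariant uniform measure on the ball
(`exists_zonotope`). With `n = d - 1`, `∫ |⟨u, x⟩| = 2 ω_n ‖u‖ / (n + 2)` and `∫ ‖x‖ = (n + 1)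
ω_{n+1} / (n + 2)`. The quotient of the constants is `(d / 2) ω_d / ω_{d-1}`.

The whole zero set is not regular with `φ 0 = 1`, because hyperplanes of different families cross.
So `Γ = gridUnion s η` keeps only the points of each hyperplane where all other factors have
absolute value at least `η`. Small balls then see one hyperplane only, which gives regularity
(`exists_isPhiRegular`) and, by the mass distribution principle, a sharp lower bound for the
Hausdorff measure (`sum_gridMeasure_le_hausdorffSurfaceMeasure`). The density lost tends to `0` with
`η` because the vectors are pairwise non-parallel (`eventually_gridMeasure_abs_cos_lt_le`). -/

/-! ### Spherical Hausdorff measure and its comparison with Lebesgue measure. -/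

theorem hausdorffPremeasure_le {d k : ℕ} {ε : ℝ} {E : Set (EuclideanSpace ℝ (Fin d))}
    {t : Set (EuclideanSpace ℝ (Fin d) × ℝ)} (ht : t.Countable)
    (htε : ∀ p ∈ t, 0 < p.2 ∧ p.2 ≤ ε) (hE : E ⊆ ⋃ p ∈ t, closedBall p.1 p.2) :
    hausdorffPremeasure k ε E ≤
      ENNReal.ofReal (unitBallVolume k) * ∑' p : t, ENNReal.ofReal p.1.2 ^ k :=
  (iInf_le _ t).trans <| (iInf_le _ ht).trans <| (iInf_le _ htε).trans <| iInf_le _ hE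

theorem le_hausdorffPremeasure {d k : ℕ} {ε : ℝ} {E : Set (EuclideanSpace ℝ (Fin d))} {c : ℝ≥0∞}
    (h : ∀ t : Set (EuclideanSpace ℝ (Fin d) × ℝ), t.Countable →
      (∀ p ∈ t, 0 < p.2 ∧ p.2 ≤ ε) → E ⊆ ⋃ p ∈ t, closedBall p.1 p.2 →
      c ≤ ENNReal.ofReal (unitBallVolume k) * ∑' p : t, ENNReal.ofReal p.1.2 ^ k) :
    c ≤ hausdorffPremeasure k ε E :=
  le_iInf fun t => le_iInf fun ht => le_iInf fun htε => le_iInf fun hE => h t ht htε hE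

theorem hausdorffPremeasure_mono {d k : ℕ} {ε : ℝ} {E F : Set (EuclideanSpace ℝ (Fin d))}
    (h : E ⊆ F) : hausdorffPremeasure k ε E ≤ hausdorffPremeasure k ε F :=
  le_hausdorffPremeasure fun _ ht htε hF => hausdorffPremeasure_le ht htε (h.trans hF)

theorem hausdorffPremeasure_union_le {d k : ℕ} {ε : ℝ} (E F : Set (EuclideanSpace ℝ (Fin d))) :
    hausdorffPremeasure k ε (E ∪ F) ≤ hausdorffPremeasure k ε E + hausdorffPremeasure k ε F := by
  conv_rhs => simp only [hausdorffPremeasure, ENNReal.iInf_add, ENNReal.add_iInf]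
  refine le_iInf fun u => le_iInf fun hu => le_iInf fun huε => le_iInf fun hF => ?_
  refine le_iInf fun t => le_iInf fun ht => le_iInf fun htε => le_iInf fun hE => ?_
  refine (hausdorffPremeasure_le (t := t ∪ u) (ht.union hu) ?_ ?_).trans ?_
  · rintro p (hp | hp)
    exacts [htε p hp, huε p hp]
  · rw [biUnion_union]
    exact union_subset_union hE hF
  · rw [← mul_add]
    gcongr
    exact ENNReal.tsum_union_le (fun p : EuclideanSpace ℝ (Fin d) × ℝ => ENNReal.ofReal p.2 ^ k) t u

theorem hausdorffSurfaceMeasure_mono {d k : ℕ} {E F : Set (EuclideanSpace ℝ (Fin d))}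
    (h : E ⊆ F) : hausdorffSurfaceMeasure k E ≤ hausdorffSurfaceMeasure k F :=
  iSup₂_mono fun _ _ => hausdorffPremeasure_mono h

theorem hausdorffSurfaceMeasure_union_le {d k : ℕ} (E F : Set (EuclideanSpace ℝ (Fin d))) :
    hausdorffSurfaceMeasure k (E ∪ F) ≤
      hausdorffSurfaceMeasure k E + hausdorffSurfaceMeasure k F :=
  iSup₂_le fun ε hε => (hausdorffPremeasure_union_le E F).trans <|
    add_le_add (le_iSup₂ (f := fun (ε : ℝ) (_ : 0 < ε) => hausdorffPremeasure k ε E) ε hε)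
      (le_iSup₂ (f := fun (ε : ℝ) (_ : 0 < ε) => hausdorffPremeasure k ε F) ε hε)

theorem hausdorffSurfaceMeasure_empty {d k : ℕ} :
    hausdorffSurfaceMeasure k (∅ : Set (EuclideanSpace ℝ (Fin d))) = 0 := by
  refine nonpos_iff_eq_zero.1 (iSup₂_le fun ε hε => ?_)
  refine (hausdorffPremeasure_le (t := ∅) countable_empty (by simp) (by simp)).trans ?_
  simp

theorem hausdorffSurfaceMeasure_biUnion_le {ι : Type*} {d k : ℕ} (s : Finset ι)
    (E : ι → Set (EuclideanSpace ℝ (Fin d))) :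
    hausdorffSurfaceMeasure k (⋃ i ∈ s, E i) ≤ ∑ i ∈ s, hausdorffSurfaceMeasure k (E i) := by
  classical
  induction s using Finset.induction_on with
  | empty => simp [hausdorffSurfaceMeasure_empty]
  | insert a s ha ih =>
    rw [Finset.sum_insert ha, Finset.set_biUnion_insert]
    exact (hausdorffSurfaceMeasure_union_le _ _).trans (add_le_add le_rfl ih)

theorem volume_closedBall_eq_unitBallVolume {k : ℕ} (x : EuclideanSpace ℝ (Fin k)) {r : ℝ}
    (hr : 0 ≤ r) :
    volume (closedBall x r) = ENNReal.ofReal (unitBallVolume k) * ENNReal.ofReal r ^ k := by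
  rw [unitBallVolume, ENNReal.ofReal_toReal measure_closedBall_lt_top.ne,
    Measure.addHaar_closedBall' _ _ hr, finrank_euclideanSpace_fin, ENNReal.ofReal_pow hr, mul_comm]

theorem unitBallVolume_pos (k : ℕ) : 0 < unitBallVolume k :=
  ENNReal.toReal_pos (measure_closedBall_pos _ _ one_pos).ne' measure_closedBall_lt_top.ne

/-- The Hausdorff measure of an isometric copy of a set is at most its Lebesgue measure. -/
theorem Isometry.hausdorffSurfaceMeasure_image_le {d k : ℕ}
    {e : EuclideanSpace ℝ (Fin k) → EuclideanSpace ℝ (Fin d)} (he : Isometry e)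
    (S : Set (EuclideanSpace ℝ (Fin k))) :
    hausdorffSurfaceMeasure k (e '' S) ≤ volume S := by
  refine iSup₂_le fun ε hε => ENNReal.le_of_forall_pos_le_add fun a ha _ => ?_
  -- Besicovitch covers `S` by balls of radius at most `ε` with total volume at most `volume S + a`.
  -- Balls of the same radii about the image centres cover the image.
  obtain ⟨t, r, htc, -, hr, hcov, hsum⟩ := Besicovitch.exists_closedBall_covering_tsum_measure_le
    volume (ε := (a : ℝ≥0∞)) (by positivity) (fun _ => Ioc 0 ε) S (fun x _ δ hδ =>
      ⟨min (δ / 2) ε, ⟨⟨by positivity, min_le_right _ _⟩, by positivity,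
        (min_le_left _ _).trans_lt (by linarith)⟩⟩)
  refine le_trans ?_ hsum
  have hinj : InjOn (fun x => (e x, r x)) t := fun x _ y _ h => he.injective (Prod.ext_iff.1 h).1
  refine (hausdorffPremeasure_le (t := (fun x => (e x, r x)) '' t) (htc.image _) ?_ ?_).trans ?_
  · rintro _ ⟨x, hx, rfl⟩
    exact hr x hx
  · rintro _ ⟨y, hy, rfl⟩
    obtain ⟨x, hx, hxy⟩ := mem_iUnion₂.1 (hcov hy)
    refine mem_iUnion₂.2 ⟨_, mem_image_of_mem _ hx, ?_⟩
    simpa [mem_closedBall, he.dist_eq] using hxy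
  · rw [← ENNReal.tsum_mul_left, tsum_image (fun p : EuclideanSpace ℝ (Fin d) × ℝ =>
      ENNReal.ofReal (unitBallVolume k) * ENNReal.ofReal p.2 ^ k) hinj]
    exact ENNReal.tsum_le_tsum fun x =>
      (volume_closedBall_eq_unitBallVolume _ (hr x x.2).1.le).ge

/-- The mass distribution principle with the sharp constant. -/
theorem measure_le_hausdorffSurfaceMeasure {d k : ℕ} (μ : Measure (EuclideanSpace ℝ (Fin d)))
    {τ : ℝ} (hτ : 0 < τ)
    (h : ∀ x, ∀ r, 0 < r → r ≤ τ → μ (closedBall x r) ≤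
      ENNReal.ofReal (unitBallVolume k) * ENNReal.ofReal r ^ k)
    (E : Set (EuclideanSpace ℝ (Fin d))) : μ E ≤ hausdorffSurfaceMeasure k E := by
  refine le_trans ?_ (le_iSup₂ (f := fun (ε : ℝ) (_ : 0 < ε) => hausdorffPremeasure k ε E) τ hτ)
  refine le_hausdorffPremeasure fun t ht htε hE => ?_
  refine (measure_mono hE).trans ((measure_biUnion_le μ ht _).trans ?_)
  rw [← ENNReal.tsum_mul_left]
  exact ENNReal.tsum_le_tsum fun p => h _ _ (htε p p.2).1 (htε p p.2).2

/-! ### Products of cosines and their spectra. -/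

/-- Fourier inversion, read as: the transform of a character is the point mass at its frequency. -/
theorem SchwartzMap.integral_exp_inner_mul_fourier {d : ℕ} (ξ : EuclideanSpace ℝ (Fin d))
    (g : 𝓢(EuclideanSpace ℝ (Fin d), ℂ)) :
    ∫ x, Complex.exp (2 * Real.pi * inner ℝ x ξ * Complex.I) * (𝓕 g) x = g ξ := by
  have h : 𝓕⁻ (𝓕 g) ξ = g ξ := by rw [FourierTransform.fourierInv_fourier_eq]
  rw [← h, SchwartzMap.fourierInv_coe, Real.fourierInv_eq']
  simp

/-- A trigonometric polynomial belongs to the Paley–Wiener class of any closed set that contains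
its frequencies. -/
theorem memPaleyWienerInfty_trigonometricPolynomial {d : ℕ} {ι : Type*} (s : Finset ι)
    (c : ι → ℂ) (ξ : ι → EuclideanSpace ℝ (Fin d)) {K : Set (EuclideanSpace ℝ (Fin d))}
    (hK : IsClosed K) (hξ : ∀ i ∈ s, ξ i ∈ K) :
    MemPaleyWienerInfty K
      (fun x => ∑ i ∈ s, c i * Complex.exp (2 * Real.pi * inner ℝ x (ξ i) * Complex.I)) := by
  have hnorm : ∀ i x, ‖Complex.exp (2 * Real.pi * inner ℝ x (ξ i) * Complex.I)‖ = 1 := by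
    intro i x
    have := Complex.norm_exp_ofReal_mul_I (2 * Real.pi * inner ℝ x (ξ i))
    push_cast at this
    exact this
  have hcont : ∀ i, Continuous fun x : EuclideanSpace ℝ (Fin d) =>
      Complex.exp (2 * Real.pi * inner ℝ x (ξ i) * Complex.I) := fun i => by fun_prop
  have hf : MemLp (fun x : EuclideanSpace ℝ (Fin d) =>
      ∑ i ∈ s, c i * Complex.exp (2 * Real.pi * inner ℝ x (ξ i) * Complex.I)) ∞ volume := by
    refine memLp_top_of_bound (C := ∑ i ∈ s, ‖c i‖) ?_ (Eventually.of_forall fun x => ?_)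
    · exact (continuous_finsetSum _ fun i _ => continuous_const.mul (hcont i)).aestronglyMeasurable
    · refine (norm_sum_le _ _).trans (Finset.sum_le_sum fun i _ => ?_)
      rw [norm_mul, hnorm, mul_one]
  -- The support is the intersection of the closed sets off which the distribution vanishes. `K` is
  -- one of them, since the pairing with `g` is `∑ c i * g (ξ i)`.
  refine ⟨hf, sInter_subset_of_mem ⟨fun g hg => ?_, hK⟩⟩
  rw [TemperedDistribution.fourier_apply, Lp.toTemperedDistribution_apply]
  have h1 : ∫ x, (𝓕 g) x • (hf.toLp _) x = ∫ x, ∑ i ∈ s,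
      c i * (Complex.exp (2 * Real.pi * inner ℝ x (ξ i) * Complex.I) * (𝓕 g) x) := by
    refine integral_congr_ae ?_
    filter_upwards [hf.coeFn_toLp] with x hx
    rw [hx, smul_eq_mul, Finset.mul_sum]
    exact Finset.sum_congr rfl fun i _ => by ring
  rw [h1, integral_finsetSum]
  · refine Finset.sum_eq_zero fun i hi => ?_
    rw [integral_const_mul, SchwartzMap.integral_exp_inner_mul_fourier]
    have : g (ξ i) = 0 := by
      by_contra h
      exact hg (subset_tsupport g h) (hξ i hi)
    rw [this, mul_zero]
  · intro i _
    refine Integrable.const_mul ?_ _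
    exact (𝓕 g).integrable.bdd_mul (hcont i).aestronglyMeasurable
      (Eventually.of_forall fun x => (hnorm i x).le)

/-- Testing the bound on the support function at `u = ξ`, the signed sum itself, gives `‖ξ‖ ^ 2 ≤
‖ξ‖`. -/
theorem norm_sum_sub_sum_le_one {d : ℕ} (s t : Finset (EuclideanSpace ℝ (Fin d)))
    (hs : ∀ u, ∑ w ∈ s, |inner ℝ u w| ≤ ‖u‖) (hts : t ⊆ s) :
    ‖∑ w ∈ t, w - ∑ w ∈ s \ t, w‖ ≤ 1 := by
  set ξ := ∑ w ∈ t, w - ∑ w ∈ s \ t, w with hξ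
  by_contra! h
  have h1 : inner ℝ ξ ξ ≤ ‖ξ‖ := by
    calc inner ℝ ξ ξ = ∑ w ∈ t, inner ℝ ξ w + ∑ w ∈ s \ t, -inner ℝ ξ w := by
          conv_lhs => rw [hξ]
          rw [← hξ, inner_sub_left, sum_inner, sum_inner]
          simp only [real_inner_comm ξ, Finset.sum_neg_distrib, sub_eq_add_neg]
      _ ≤ ∑ w ∈ t, |inner ℝ ξ w| + ∑ w ∈ s \ t, |inner ℝ ξ w| :=
          add_le_add (Finset.sum_le_sum fun _ _ => le_abs_self _)
            (Finset.sum_le_sum fun _ _ => neg_le_abs _)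
      _ = ∑ w ∈ s, |inner ℝ ξ w| := by rw [add_comm, Finset.sum_sdiff hts]
      _ ≤ ‖ξ‖ := hs ξ
  rw [real_inner_self_eq_norm_sq] at h1
  nlinarith

/-- The product of the functions `cos 2π⟨x, w⟩`, `w ∈ s`. -/
noncomputable def cosProd {d : ℕ} (s : Finset (EuclideanSpace ℝ (Fin d)))
    (x : EuclideanSpace ℝ (Fin d)) : ℂ :=
  ((∏ w ∈ s, Real.cos (2 * Real.pi * inner ℝ x w) : ℝ) : ℂ)

theorem cosProd_eq_sum {d : ℕ} (s : Finset (EuclideanSpace ℝ (Fin d)))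
    (x : EuclideanSpace ℝ (Fin d)) :
    cosProd s x = ∑ t ∈ s.powerset, (1 / 2) ^ s.card *
      Complex.exp (2 * Real.pi * inner ℝ x (∑ w ∈ t, w - ∑ w ∈ s \ t, w) * Complex.I) := by
  have h : ∀ w, ((Real.cos (2 * Real.pi * inner ℝ x w) : ℝ) : ℂ) =
      1 / 2 * Complex.exp (2 * Real.pi * inner ℝ x w * Complex.I) +
      1 / 2 * Complex.exp (-(2 * Real.pi * inner ℝ x w * Complex.I)) := by
    intro w
    push_cast
    rw [Complex.cos]
    ring_nf
  rw [cosProd]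
  push_cast [h]
  rw [Finset.prod_add]
  refine Finset.sum_congr rfl fun t ht => ?_
  rw [Finset.prod_mul_distrib, Finset.prod_mul_distrib, ← Complex.exp_sum, ← Complex.exp_sum,
    Finset.prod_const, Finset.prod_const, mul_mul_mul_comm, ← pow_add, ← Complex.exp_add,
    add_comm t.card, Finset.card_sdiff_add_card_eq_card (Finset.mem_powerset.1 ht)]
  congr 2
  rw [inner_sub_right, inner_sum, inner_sum, Finset.sum_neg_distrib, ← Finset.sum_mul,
    ← Finset.sum_mul, ← Finset.mul_sum, ← Finset.mul_sum]
  push_cast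
  ring

theorem memPaleyWienerInfty_cosProd {d : ℕ} (s : Finset (EuclideanSpace ℝ (Fin d)))
    (hs : ∀ u, ∑ w ∈ s, |inner ℝ u w| ≤ ‖u‖) :
    MemPaleyWienerInfty (closedBall 0 1) (cosProd s) := by
  rw [funext (cosProd_eq_sum s)]
  refine memPaleyWienerInfty_trigonometricPolynomial s.powerset _ _ isClosed_closedBall
    fun t ht => ?_
  rw [mem_closedBall_zero_iff]
  exact norm_sum_sub_sum_le_one s t hs (Finset.mem_powerset.1 ht)

theorem continuous_cosProd {d : ℕ} (s : Finset (EuclideanSpace ℝ (Fin d))) :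
    Continuous (cosProd s) :=
  Complex.continuous_ofReal.comp (continuous_finsetProd _ fun w _ => by fun_prop)

theorem cosProd_zero {d : ℕ} (s : Finset (EuclideanSpace ℝ (Fin d))) : cosProd s 0 = 1 := by
  simp [cosProd]

theorem norm_cosProd_le_one {d : ℕ} (s : Finset (EuclideanSpace ℝ (Fin d)))
    (x : EuclideanSpace ℝ (Fin d)) : ‖cosProd s x‖ ≤ 1 := by
  rw [cosProd, Complex.norm_real, norm_prod]
  exact Finset.prod_le_one (fun _ _ => norm_nonneg _) fun w _ => Real.abs_cos_le_one _

/-- If the essential supremum were smaller, it would be exceeded on a nonempty open set, which has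
positive measure. -/
theorem eLpNorm_top_eq_of_continuous {X : Type*} [TopologicalSpace X] [MeasurableSpace X]
    {μ : Measure X} [μ.IsOpenPosMeasure] {f : X → ℂ} (hf : Continuous f)
    (x₀ : X) (h : ∀ x, ‖f x‖ ≤ ‖f x₀‖) : eLpNorm f ∞ μ = ‖f x₀‖ₑ := by
  rw [eLpNorm_exponent_top]
  refine le_antisymm ?_ ?_
  · exact essSup_le_of_ae_le _ (Eventually.of_forall fun x => enorm_le_iff_norm_le.2 (h x))
  · by_contra! hlt
    have h1 : ∀ᵐ x ∂μ, ‖f x‖ₑ ≤ eLpNormEssSup f μ := enorm_ae_le_eLpNormEssSup f μ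
    have hopen : IsOpen {x | eLpNormEssSup f μ < ‖f x‖ₑ} :=
      isOpen_lt continuous_const hf.enorm
    refine (hopen.measure_pos μ ⟨x₀, hlt⟩).ne' ?_
    rw [ae_iff] at h1
    simpa using h1

theorem eLpNorm_cosProd {d : ℕ} (s : Finset (EuclideanSpace ℝ (Fin d))) :
    eLpNorm (cosProd s) ∞ volume = 1 := by
  rw [eLpNorm_top_eq_of_continuous (continuous_cosProd s) 0, cosProd_zero, enorm_one]
  intro x
  rw [cosProd_zero, norm_one]
  exact norm_cosProd_le_one s x

/-! ### Isometric charts of hyperplanes and slicing of volume. -/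

/-- The point `(t, y)` of `ℝ × ℝ^n = ℝ^(n + 1)`. -/
noncomputable def euclideanCons {n : ℕ} (t : ℝ) (y : EuclideanSpace ℝ (Fin n)) :
    EuclideanSpace ℝ (Fin (n + 1)) :=
  WithLp.toLp 2 (Fin.cons t y)

/-- The last `n` coordinates of a point of `ℝ^(n + 1)`. -/
noncomputable def euclideanTail {n : ℕ} (x : EuclideanSpace ℝ (Fin (n + 1))) :
    EuclideanSpace ℝ (Fin n) :=
  WithLp.toLp 2 (Fin.tail x)

@[simp]
theorem euclideanCons_zero {n : ℕ} (t : ℝ) (y : EuclideanSpace ℝ (Fin n)) :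
    euclideanCons t y 0 = t := rfl

@[simp]
theorem euclideanCons_euclideanTail {n : ℕ} (x : EuclideanSpace ℝ (Fin (n + 1))) :
    euclideanCons (x 0) (euclideanTail x) = x := by
  ext i
  exact congrFun (Fin.cons_self_tail (fun i => x i)) i

theorem euclideanCons_add {n : ℕ} (t u : ℝ) (y z : EuclideanSpace ℝ (Fin n)) :
    euclideanCons (t + u) (y + z) = euclideanCons t y + euclideanCons u z := by
  ext i
  refine Fin.cases rfl (fun j => rfl) i

theorem euclideanCons_sub {n : ℕ} (t u : ℝ) (y z : EuclideanSpace ℝ (Fin n)) :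
    euclideanCons t y - euclideanCons u z = euclideanCons (t - u) (y - z) := by
  ext i
  refine Fin.cases rfl (fun j => rfl) i

theorem norm_sq_euclideanCons {n : ℕ} (t : ℝ) (y : EuclideanSpace ℝ (Fin n)) :
    ‖euclideanCons t y‖ ^ 2 = t ^ 2 + ‖y‖ ^ 2 := by
  rw [EuclideanSpace.norm_sq_eq, EuclideanSpace.norm_sq_eq, Fin.sum_univ_succ]
  simp [euclideanCons]

theorem dist_euclideanCons_right {n : ℕ} (t : ℝ) (y z : EuclideanSpace ℝ (Fin n)) :
    dist (euclideanCons t y) (euclideanCons t z) = dist y z := by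
  rw [dist_eq_norm, dist_eq_norm, euclideanCons_sub, sub_self]
  refine (sq_eq_sq₀ (norm_nonneg _) (norm_nonneg _)).1 ?_
  rw [norm_sq_euclideanCons, zero_pow two_ne_zero, zero_add]

theorem dist_euclideanCons_left {n : ℕ} (t u : ℝ) (y : EuclideanSpace ℝ (Fin n)) :
    dist (euclideanCons t y) (euclideanCons u y) = |t - u| := by
  rw [dist_eq_norm, euclideanCons_sub, sub_self]
  refine (sq_eq_sq₀ (norm_nonneg _) (abs_nonneg _)).1 ?_
  rw [norm_sq_euclideanCons, norm_zero, sq_abs, zero_pow two_ne_zero, add_zero]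

theorem dist_euclideanTail_le {n : ℕ} (x y : EuclideanSpace ℝ (Fin (n + 1))) :
    dist (euclideanTail x) (euclideanTail y) ≤ dist x y := by
  conv_rhs => rw [← euclideanCons_euclideanTail x, ← euclideanCons_euclideanTail y]
  rw [dist_eq_norm, dist_eq_norm, euclideanCons_sub]
  refine (sq_le_sq₀ (norm_nonneg _) (norm_nonneg _)).1 ?_
  rw [norm_sq_euclideanCons]
  exact le_add_of_nonneg_left (sq_nonneg _)

theorem measurePreserving_euclideanCons (n : ℕ) :
    MeasurePreserving (fun p : ℝ × EuclideanSpace ℝ (Fin n) => euclideanCons p.1 p.2) := by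
  have h1 : MeasurePreserving (fun p : ℝ × EuclideanSpace ℝ (Fin n) => (p.1, WithLp.ofLp p.2))
      (volume.prod volume) (volume.prod volume) :=
    (MeasurePreserving.id volume).prod (PiLp.volume_preserving_ofLp (Fin n))
  have h2 := (volume_preserving_piFinSuccAbove (fun _ : Fin (n + 1) => ℝ) 0).symm
  have h3 := (PiLp.volume_preserving_toLp (Fin (n + 1))).comp (h2.comp h1)
  have e : (fun p : ℝ × EuclideanSpace ℝ (Fin n) => euclideanCons p.1 p.2) =
      WithLp.toLp 2 ∘ (MeasurableEquiv.piFinSuccAbove (fun _ : Fin (n + 1) => ℝ) 0).symm ∘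
        fun p => (p.1, WithLp.ofLp p.2) := by
    ext p i
    simp [euclideanCons, MeasurableEquiv.piFinSuccAbove]
  rw [e]
  exact h3

theorem exists_linearIsometryEquiv_inner_eq {n : ℕ} (w : EuclideanSpace ℝ (Fin (n + 1))) :
    ∃ U : EuclideanSpace ℝ (Fin (n + 1)) ≃ₗᵢ[ℝ] EuclideanSpace ℝ (Fin (n + 1)),
      ∀ x, inner ℝ (U x) w = ‖w‖ * x 0 := by
  rcases eq_or_ne w 0 with rfl | hw
  · exact ⟨LinearIsometryEquiv.refl ℝ _, by simp⟩
  · have hv : Orthonormal ℝ (({0} : Set (Fin (n + 1))).domRestrict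
        fun _ : Fin (n + 1) => ‖w‖⁻¹ • w) := by
      refine ⟨fun i => ?_, fun i j hij => (hij (Subsingleton.elim _ _)).elim⟩
      change ‖‖w‖⁻¹ • w‖ = 1
      rw [norm_smul, norm_inv, norm_norm, inv_mul_cancel₀ (norm_ne_zero_iff.2 hw)]
    obtain ⟨b, hb⟩ := hv.exists_orthonormalBasis_extension_of_card_eq (by simp)
    refine ⟨b.repr.symm, fun x => ?_⟩
    have hw' : w = b.repr.symm (‖w‖ • EuclideanSpace.single 0 1) := by
      rw [map_smul, b.repr_symm_single, hb 0 (mem_singleton _), smul_smul,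
        mul_inv_cancel₀ (norm_ne_zero_iff.2 hw), one_smul]
    conv_lhs => rw [hw']
    rw [LinearIsometryEquiv.inner_map_map, inner_smul_right, EuclideanSpace.inner_single_right]
    simp

/-- A rotation that takes the first coordinate axis to the direction of `w`. -/
noncomputable def axisRotation {n : ℕ} (w : EuclideanSpace ℝ (Fin (n + 1))) :
    EuclideanSpace ℝ (Fin (n + 1)) ≃ₗᵢ[ℝ] EuclideanSpace ℝ (Fin (n + 1)) :=
  (exists_linearIsometryEquiv_inner_eq w).choose

theorem inner_axisRotation {n : ℕ} (w x : EuclideanSpace ℝ (Fin (n + 1))) :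
    inner ℝ (axisRotation w x) w = ‖w‖ * x 0 :=
  (exists_linearIsometryEquiv_inner_eq w).choose_spec x

/-- The parametrization of the hyperplane orthogonal to `w` at signed distance `t` from `0`. -/
noncomputable def hyperplaneChart {n : ℕ} (w : EuclideanSpace ℝ (Fin (n + 1))) (t : ℝ)
    (y : EuclideanSpace ℝ (Fin n)) : EuclideanSpace ℝ (Fin (n + 1)) :=
  axisRotation w (euclideanCons t y)

theorem inner_hyperplaneChart {n : ℕ} (w : EuclideanSpace ℝ (Fin (n + 1))) (t : ℝ)
    (y : EuclideanSpace ℝ (Fin n)) : inner ℝ (hyperplaneChart w t y) w = ‖w‖ * t :=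
  inner_axisRotation w _

theorem isometry_hyperplaneChart {n : ℕ} (w : EuclideanSpace ℝ (Fin (n + 1))) (t : ℝ) :
    Isometry (hyperplaneChart w t) :=
  (axisRotation w).isometry.comp (Isometry.of_dist_eq (dist_euclideanCons_right t))

theorem dist_hyperplaneChart_left {n : ℕ} (w : EuclideanSpace ℝ (Fin (n + 1))) (t u : ℝ)
    (y : EuclideanSpace ℝ (Fin n)) :
    dist (hyperplaneChart w t y) (hyperplaneChart w u y) = |t - u| := by
  rw [hyperplaneChart, hyperplaneChart, (axisRotation w).dist_map, dist_euclideanCons_left]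

theorem mem_range_hyperplaneChart {n : ℕ} {w x : EuclideanSpace ℝ (Fin (n + 1))} {t : ℝ}
    (hw : w ≠ 0) (h : inner ℝ x w = ‖w‖ * t) : x ∈ range (hyperplaneChart w t) := by
  have h0 : (axisRotation w).symm x 0 = t := by
    have := inner_axisRotation w ((axisRotation w).symm x)
    rw [LinearIsometryEquiv.apply_symm_apply, h] at this
    exact (mul_left_cancel₀ (norm_ne_zero_iff.2 hw) this).symm
  refine ⟨euclideanTail ((axisRotation w).symm x), ?_⟩
  rw [hyperplaneChart, ← h0, euclideanCons_euclideanTail, LinearIsometryEquiv.apply_symm_apply]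

/-- Orthogonal projection to the hyperplane is `1`-Lipschitz, so the slice lies in an `n`-ball of
radius `r` about the projected centre. -/
theorem volume_preimage_hyperplaneChart_closedBall_le {n : ℕ}
    (w x : EuclideanSpace ℝ (Fin (n + 1))) (t : ℝ) {r : ℝ} (hr : 0 ≤ r) :
    volume (hyperplaneChart w t ⁻¹' closedBall x r) ≤
      ENNReal.ofReal (unitBallVolume n) * ENNReal.ofReal r ^ n := by
  rw [← volume_closedBall_eq_unitBallVolume (euclideanTail ((axisRotation w).symm x)) hr]
  refine measure_mono fun y hy => ?_
  rw [mem_preimage, mem_closedBall, hyperplaneChart, ← (axisRotation w).symm.dist_map,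
    LinearIsometryEquiv.symm_apply_apply] at hy
  exact (dist_euclideanTail_le (euclideanCons t y) _).trans hy

theorem hausdorffSurfaceMeasure_hyperplane_inter_closedBall_le {n : ℕ}
    {w : EuclideanSpace ℝ (Fin (n + 1))} (hw : w ≠ 0) (c : ℝ) (x : EuclideanSpace ℝ (Fin (n + 1)))
    {r : ℝ} (hr : 0 ≤ r) :
    hausdorffSurfaceMeasure n ({y | inner ℝ y w = c} ∩ closedBall x r) ≤
      ENNReal.ofReal (unitBallVolume n) * ENNReal.ofReal r ^ n := by
  refine le_trans ?_ ((isometry_hyperplaneChart w (c / ‖w‖)).hausdorffSurfaceMeasure_image_le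
    _ |>.trans (volume_preimage_hyperplaneChart_closedBall_le w x (c / ‖w‖) hr))
  refine hausdorffSurfaceMeasure_mono ?_
  rintro y ⟨hy, hyx⟩
  obtain ⟨z, rfl⟩ := mem_range_hyperplaneChart (t := c / ‖w‖) hw
    (by rw [mul_div_cancel₀ _ (norm_ne_zero_iff.2 hw)]; exact hy)
  exact mem_image_of_mem _ hyx

theorem volume_eq_lintegral_hyperplaneChart {n : ℕ} (w : EuclideanSpace ℝ (Fin (n + 1)))
    {S : Set (EuclideanSpace ℝ (Fin (n + 1)))} (hS : MeasurableSet S) :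
    volume S = ∫⁻ t : ℝ, volume (hyperplaneChart w t ⁻¹' S) := by
  have h := (axisRotation w).measurePreserving.comp (measurePreserving_euclideanCons n)
  rw [← h.measure_preimage hS.nullMeasurableSet, Measure.volume_eq_prod,
    Measure.prod_apply (h.measurable hS)]
  rfl

/-! ### Surface measure of a family of equidistant hyperplanes. -/

/-- For `a = ‖w‖` each interval runs from one zero hyperplane of `cos 2π⟨x, w⟩` to the next. -/
theorem lintegral_eq_tsum_Ioc (f : ℝ → ℝ≥0∞) {a : ℝ} (ha : 0 < a) :
    ∫⁻ t, f t = ∑' k : ℤ, ∫⁻ t in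
      Ioc ((1 / 4 + k / 2) / a) ((1 / 4 + k / 2) / a + 1 / (2 * a)), f t := by
  have hp : 0 < 1 / (2 * a) := by positivity
  have e1 : ∀ k : ℤ, (1 / 4 + (k : ℝ) / 2) / a = 1 / 4 / a + k • (1 / (2 * a)) := fun k => by
    rw [zsmul_eq_mul]
    field_simp
  have e2 : ∀ k : ℤ, (1 / 4 + (k : ℝ) / 2) / a + 1 / (2 * a) =
      1 / 4 / a + (k + 1) • (1 / (2 * a)) := fun k => by
    rw [e1, add_smul, one_smul, add_assoc]
  simp_rw [e2, e1]
  rw [← lintegral_iUnion (fun _ => measurableSet_Ioc) (pairwise_disjoint_Ioc_add_zsmul _ _),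
    iUnion_Ioc_add_zsmul hp, setLIntegral_univ]

/-- The surface measure of the zero set of `cos 2π⟨x, w⟩`, that is of the union of the
hyperplanes `⟨x, w⟩ = 1 / 4 + k / 2`. -/
noncomputable def gridMeasure {n : ℕ} (w : EuclideanSpace ℝ (Fin (n + 1))) :
    Measure (EuclideanSpace ℝ (Fin (n + 1))) :=
  Measure.sum fun k : ℤ =>
    Measure.map (hyperplaneChart w ((1 / 4 + k / 2) / ‖w‖)) volume

theorem gridMeasure_apply {n : ℕ} (w : EuclideanSpace ℝ (Fin (n + 1)))
    {S : Set (EuclideanSpace ℝ (Fin (n + 1)))} (hS : MeasurableSet S) :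
    gridMeasure w S =
      ∑' k : ℤ, volume (hyperplaneChart w ((1 / 4 + k / 2) / ‖w‖) ⁻¹' S) := by
  rw [gridMeasure, Measure.sum_apply _ hS]
  exact tsum_congr fun k =>
    Measure.map_apply (isometry_hyperplaneChart w _).continuous.measurable hS

/-- Sliding a slice along the normal back to the preceding hyperplane moves points by at most the
spacing `1 / (2‖w‖)`. With the reverse bound below, this gives the grid density `2‖w‖`. -/
theorem volume_closedBall_le_gridMeasure {n : ℕ} {w : EuclideanSpace ℝ (Fin (n + 1))}
    (hw : w ≠ 0) (x : EuclideanSpace ℝ (Fin (n + 1))) (R : ℝ) :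
    volume (closedBall x (R - 1 / (2 * ‖w‖))) ≤
      ENNReal.ofReal (1 / (2 * ‖w‖)) * gridMeasure w (closedBall x R) := by
  rw [volume_eq_lintegral_hyperplaneChart w measurableSet_closedBall,
    gridMeasure_apply w measurableSet_closedBall,
    lintegral_eq_tsum_Ioc _ (norm_pos_iff.2 hw), ← ENNReal.tsum_mul_left]
  refine ENNReal.tsum_le_tsum fun k => ?_
  set T := (1 / 4 + (k : ℝ) / 2) / ‖w‖
  have hvol : volume (Ioc T (T + 1 / (2 * ‖w‖))) = ENNReal.ofReal (1 / (2 * ‖w‖)) := by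
    rw [Real.volume_Ioc, add_sub_cancel_left]
  rw [← hvol, mul_comm (volume (Ioc _ _)), ← setLIntegral_const (Ioc T (T + 1 / (2 * ‖w‖)))]
  refine setLIntegral_mono' measurableSet_Ioc fun t ht => ?_
  refine measure_mono fun y hy => ?_
  rw [mem_preimage, mem_closedBall] at hy ⊢
  have h2 : dist (hyperplaneChart w T y) (hyperplaneChart w t y) ≤ 1 / (2 * ‖w‖) := by
    rw [dist_hyperplaneChart_left, abs_le]
    constructor <;> linarith [ht.1, ht.2]
  have := dist_triangle (hyperplaneChart w T y) (hyperplaneChart w t y) x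
  linarith

theorem gridMeasure_closedBall_le {n : ℕ} {w : EuclideanSpace ℝ (Fin (n + 1))}
    (hw : w ≠ 0) (x : EuclideanSpace ℝ (Fin (n + 1))) (R : ℝ) :
    ENNReal.ofReal (1 / (2 * ‖w‖)) * gridMeasure w (closedBall x R) ≤
      volume (closedBall x (R + 1 / (2 * ‖w‖))) := by
  rw [volume_eq_lintegral_hyperplaneChart w measurableSet_closedBall,
    gridMeasure_apply w measurableSet_closedBall,
    lintegral_eq_tsum_Ioc _ (norm_pos_iff.2 hw), ← ENNReal.tsum_mul_left]
  refine ENNReal.tsum_le_tsum fun k => ?_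
  set T := (1 / 4 + (k : ℝ) / 2) / ‖w‖
  have hvol : volume (Ioc T (T + 1 / (2 * ‖w‖))) = ENNReal.ofReal (1 / (2 * ‖w‖)) := by
    rw [Real.volume_Ioc, add_sub_cancel_left]
  rw [← hvol, mul_comm (volume (Ioc _ _)), ← setLIntegral_const (Ioc T (T + 1 / (2 * ‖w‖)))]
  refine setLIntegral_mono' measurableSet_Ioc fun t ht => ?_
  refine measure_mono fun y hy => ?_
  rw [mem_preimage, mem_closedBall] at hy ⊢
  have h2 : dist (hyperplaneChart w t y) (hyperplaneChart w T y) ≤ 1 / (2 * ‖w‖) := by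
    rw [dist_hyperplaneChart_left, abs_le]
    constructor <;> linarith [ht.1, ht.2]
  have := dist_triangle (hyperplaneChart w t y) (hyperplaneChart w T y) x
  linarith

theorem gridMeasure_preimage_add_right {n : ℕ} {w q : EuclideanSpace ℝ (Fin (n + 1))}
    (hw : w ≠ 0) (hq : inner ℝ q w = 0) {S : Set (EuclideanSpace ℝ (Fin (n + 1)))}
    (hS : MeasurableSet S) : gridMeasure w ((· + q) ⁻¹' S) = gridMeasure w S := by
  rw [gridMeasure_apply w hS, gridMeasure_apply w (measurable_add_const q hS)]
  refine tsum_congr fun k => ?_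
  obtain ⟨z, hz⟩ := mem_range_hyperplaneChart (t := 0) hw (by rw [hq, mul_zero])
  rw [← measure_preimage_add_right volume z (hyperplaneChart w _ ⁻¹' S)]
  congr 1
  ext y
  have h : hyperplaneChart w ((1 / 4 + k / 2) / ‖w‖) y + q =
      hyperplaneChart w ((1 / 4 + k / 2) / ‖w‖) (y + z) := by
    rw [← hz, hyperplaneChart, hyperplaneChart, hyperplaneChart, ← map_add, ← euclideanCons_add,
      add_zero]
  simp only [mem_preimage, h]

/-- At most one term of the sum over `k` is nonzero, and that term is a slice of the ball. -/
theorem gridMeasure_le_of_subset_hyperplane {n : ℕ} {w : EuclideanSpace ℝ (Fin (n + 1))}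
    (hw : w ≠ 0) (x : EuclideanSpace ℝ (Fin (n + 1))) {r c : ℝ} (hr : 0 ≤ r)
    {S : Set (EuclideanSpace ℝ (Fin (n + 1)))} (hS : MeasurableSet S) (hSx : S ⊆ closedBall x r)
    (hSc : ∀ y ∈ S, inner ℝ y w = c) :
    gridMeasure w S ≤ ENNReal.ofReal (unitBallVolume n) * ENNReal.ofReal r ^ n := by
  have hw' : ‖w‖ ≠ 0 := norm_ne_zero_iff.2 hw
  rw [gridMeasure_apply w hS]
  have hkey : ∀ k : ℤ, (1 / 4 + (k : ℝ) / 2) ≠ c →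
      volume (hyperplaneChart w ((1 / 4 + k / 2) / ‖w‖) ⁻¹' S) = 0 := by
    intro k hk
    convert measure_empty (μ := volume)
    refine eq_empty_of_forall_notMem fun y hy => hk ?_
    rw [← hSc _ hy, inner_hyperplaneChart, mul_div_cancel₀ _ hw']
  by_cases h : ∃ k : ℤ, (1 / 4 + (k : ℝ) / 2) = c
  · obtain ⟨k, hk⟩ := h
    rw [tsum_eq_single k]
    · exact (measure_mono (preimage_mono hSx)).trans
        (volume_preimage_hyperplaneChart_closedBall_le w x _ hr)
    · intro j hj
      refine hkey j fun h => hj ?_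
      have : (j : ℝ) = k := by linarith
      exact_mod_cast this
  · push Not at h
    simp only [hkey _ (h _), tsum_zero, zero_le]

/-! ### Zonotopes of nearly maximal edge length. -/

theorem measureReal_ball_zero_one (k : ℕ) :
    volume.real (ball (0 : EuclideanSpace ℝ (Fin k)) 1) = unitBallVolume k := by
  rw [unitBallVolume, Measure.addHaar_closedBall _ _ zero_le_one, Measure.real]
  simp

theorem setIntegral_closedBall_norm_pow (k p : ℕ) (hk : k ≠ 0) :
    ∫ x in closedBall (0 : EuclideanSpace ℝ (Fin k)) 1, ‖x‖ ^ p =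
      k * unitBallVolume k / (k + p) := by
  have : Nonempty (Fin k) := ⟨⟨0, Nat.pos_of_ne_zero hk⟩⟩
  have h1 : ∫ x in closedBall (0 : EuclideanSpace ℝ (Fin k)) 1, ‖x‖ ^ p =
      ∫ x : EuclideanSpace ℝ (Fin k), (Iic (1 : ℝ)).indicator (fun r => r ^ p) ‖x‖ := by
    rw [← integral_indicator measurableSet_closedBall]
    refine integral_congr_ae (Eventually.of_forall fun x => ?_)
    simp only [indicator, mem_closedBall_zero_iff, mem_Iic]
  have h2 : ∫ y in Ioi (0 : ℝ), y ^ (k - 1) • (Iic (1 : ℝ)).indicator (fun r => r ^ p) y =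
      1 / (k + p) := by
    have h3 : ∀ y : ℝ, y ^ (k - 1) • (Iic (1 : ℝ)).indicator (fun r => r ^ p) y =
        (Iic (1 : ℝ)).indicator (fun r => r ^ (k - 1 + p)) y := fun y => by
      simp only [indicator]
      split_ifs <;> simp [pow_add]
    simp_rw [h3]
    rw [setIntegral_indicator measurableSet_Iic, Ioi_inter_Iic,
      ← intervalIntegral.integral_of_le zero_le_one, integral_pow]
    have : ((k - 1 + p : ℕ) : ℝ) + 1 = k + p := by
      rw [← Nat.cast_add_one, show k - 1 + p + 1 = k + p by omega, Nat.cast_add]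
    rw [this]
    simp
  rw [h1, integral_fun_norm_addHaar, finrank_euclideanSpace_fin, h2, measureReal_ball_zero_one,
    nsmul_eq_mul, smul_eq_mul]
  ring

theorem integral_abs_Icc_neg (a : ℝ) (ha : 0 ≤ a) : ∫ t in Icc (-a) a, |t| = a ^ 2 := by
  rw [integral_Icc_eq_integral_Ioc, ← intervalIntegral.integral_of_le (by linarith),
    ← intervalIntegral.integral_add_adjacent_intervals (b := 0)
      (continuous_abs.intervalIntegrable _ _) (continuous_abs.intervalIntegrable _ _)]
  have h1 : ∫ t in (-a)..0, |t| = ∫ t in (-a)..0, -t :=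
    intervalIntegral.integral_congr fun t ht => by
      rw [uIcc_of_le (by linarith)] at ht
      exact abs_of_nonpos ht.2
  have h2 : ∫ t in (0 : ℝ)..a, |t| = ∫ t in (0 : ℝ)..a, t :=
    intervalIntegral.integral_congr fun t ht => by
      rw [uIcc_of_le ha] at ht
      exact abs_of_nonneg ht.1
  rw [h1, h2, intervalIntegral.integral_neg, integral_id, integral_id]
  ring

/-- Slice along the direction of `u`: over a point `y` of the unit `n`-ball the integral of `|t|` is
`1 - ‖y‖ ^ 2`, and integrating over `y` gives `ω_n - n ω_n / (n + 2)`. -/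
theorem setIntegral_closedBall_abs_inner {n : ℕ} (hn : n ≠ 0)
    (u : EuclideanSpace ℝ (Fin (n + 1))) :
    ∫ x in closedBall (0 : EuclideanSpace ℝ (Fin (n + 1))) 1, |inner ℝ u x| =
      2 * unitBallVolume n / (n + 2) * ‖u‖ := by
  have hmp := (axisRotation u).measurePreserving.comp (measurePreserving_euclideanCons n)
  have hint : Integrable ((closedBall (0 : EuclideanSpace ℝ (Fin (n + 1))) 1).indicator
      fun x => |inner ℝ u x|) := by
    rw [integrable_indicator_iff measurableSet_closedBall]
    exact (by fun_prop : Continuous fun x : EuclideanSpace ℝ (Fin (n + 1)) =>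
      |inner ℝ u x|).continuousOn.integrableOn_compact (isCompact_closedBall _ _)
  have key : ∀ (t : ℝ) (y : EuclideanSpace ℝ (Fin n)),
      (closedBall (0 : EuclideanSpace ℝ (Fin (n + 1))) 1).indicator (fun x => |inner ℝ u x|)
        (axisRotation u (euclideanCons t y)) =
      (closedBall (0 : EuclideanSpace ℝ (Fin n)) 1).indicator (fun y => ‖u‖ *
        (Icc (-√(1 - ‖y‖ ^ 2)) √(1 - ‖y‖ ^ 2)).indicator (fun t => |t|) t) y := by
    intro t y
    have h1 : axisRotation u (euclideanCons t y) ∈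
        closedBall (0 : EuclideanSpace ℝ (Fin (n + 1))) 1 ↔ t ^ 2 + ‖y‖ ^ 2 ≤ 1 := by
      rw [mem_closedBall_zero_iff, LinearIsometryEquiv.norm_map, ← norm_sq_euclideanCons,
        sq_le_one_iff₀ (norm_nonneg _)]
    have h2 : y ∈ closedBall (0 : EuclideanSpace ℝ (Fin n)) 1 ↔ ‖y‖ ^ 2 ≤ 1 := by
      rw [mem_closedBall_zero_iff, sq_le_one_iff₀ (norm_nonneg _)]
    by_cases hy : ‖y‖ ^ 2 ≤ 1
    · have h3 : t ∈ Icc (-√(1 - ‖y‖ ^ 2)) √(1 - ‖y‖ ^ 2) ↔ t ^ 2 + ‖y‖ ^ 2 ≤ 1 := by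
        rw [mem_Icc, ← abs_le, ← sq_le_sq₀ (abs_nonneg _) (Real.sqrt_nonneg _), sq_abs,
          Real.sq_sqrt (by linarith), le_sub_iff_add_le]
      rw [indicator_of_mem (h2.2 hy)]
      by_cases ht : t ^ 2 + ‖y‖ ^ 2 ≤ 1
      · rw [indicator_of_mem (h1.2 ht), indicator_of_mem (h3.2 ht), real_inner_comm,
          inner_axisRotation, abs_mul, abs_norm, euclideanCons_zero]
      · rw [indicator_of_notMem (mt h1.1 ht), indicator_of_notMem (mt h3.1 ht), mul_zero]
    · rw [indicator_of_notMem (mt h2.1 hy), indicator_of_notMem]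
      exact fun h => hy (by nlinarith [h1.1 h, sq_nonneg t])
  rw [← integral_indicator measurableSet_closedBall]
  have hint2 := hmp.integrable_comp_of_integrable hint
  have h4 := integral_map (μ := volume.prod volume) hmp.measurable.aemeasurable
    (by rw [← Measure.volume_eq_prod, hmp.map_eq]; exact hint.aestronglyMeasurable)
  rw [← Measure.volume_eq_prod, hmp.map_eq] at h4
  rw [h4, Measure.volume_eq_prod, integral_prod_symm _ (by exact hint2)]
  simp only [Function.comp_apply, key]
  have h5 : ∀ y : EuclideanSpace ℝ (Fin n), ∫ t : ℝ,
      (closedBall (0 : EuclideanSpace ℝ (Fin n)) 1).indicator (fun y => ‖u‖ *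
        (Icc (-√(1 - ‖y‖ ^ 2)) √(1 - ‖y‖ ^ 2)).indicator (fun t => |t|) t) y =
      (closedBall (0 : EuclideanSpace ℝ (Fin n)) 1).indicator
        (fun y => ‖u‖ * (1 - ‖y‖ ^ 2)) y := by
    intro y
    by_cases hy : y ∈ closedBall (0 : EuclideanSpace ℝ (Fin n)) 1
    · have : ‖y‖ ^ 2 ≤ 1 := by
        rwa [mem_closedBall_zero_iff, ← sq_le_one_iff₀ (norm_nonneg _)] at hy
      simp only [indicator_of_mem hy]
      rw [integral_const_mul, integral_indicator measurableSet_Icc,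
        integral_abs_Icc_neg _ (Real.sqrt_nonneg _), Real.sq_sqrt (by linarith)]
    · simp only [indicator_of_notMem hy, integral_zero]
  simp only [h5]
  rw [integral_indicator measurableSet_closedBall, integral_const_mul, integral_sub,
    setIntegral_closedBall_norm_pow n 2 hn, setIntegral_const]
  · rw [measureReal_def, ← unitBallVolume]
    push_cast
    field_simp
    simp
    ring
  · exact continuousOn_const.integrableOn_compact (isCompact_closedBall _ _)
  · exact (by fun_prop : Continuous fun y : EuclideanSpace ℝ (Fin n) =>
      ‖y‖ ^ 2).continuousOn.integrableOn_compact (isCompact_closedBall _ _)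

/-- Finitely many vectors can be merged into pairwise non-parallel ones that generate the same
zonotope. -/
theorem exists_nonparallel_finset {ι E : Type*} [NormedAddCommGroup E] [InnerProductSpace ℝ E]
    (s : Finset ι) (p : ι → E) :
    ∃ t : Finset E, (∀ w ∈ t, w ≠ 0) ∧ (∀ w ∈ t, ∀ w' ∈ t, w ≠ w' → ∀ c : ℝ, w' ≠ c • w) ∧
      (∀ u, ∑ w ∈ t, |inner ℝ u w| = ∑ i ∈ s, |inner ℝ u (p i)|) ∧
      ∑ w ∈ t, ‖w‖ = ∑ i ∈ s, ‖p i‖ := by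
  classical
  induction s using Finset.induction_on with
  | empty => exact ⟨∅, by simp⟩
  | insert i s hi ih =>
    obtain ⟨t, h0, hpar, hin, hnorm⟩ := ih
    simp only [Finset.sum_insert hi]
    by_cases ha : p i = 0
    · exact ⟨t, h0, hpar, by simpa [ha] using hin, by simpa [ha] using hnorm⟩
    by_cases hb : ∃ b ∈ t, ∃ c : ℝ, p i = c • b
    · obtain ⟨b, hbt, c, hc⟩ := hb
      have hpos : 0 < 1 + |c| := by positivity
      have hnot : ∀ w ∈ t.erase b, ∀ a : ℝ, w ≠ a • b := fun w hw a h =>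
        hpar b hbt w (Finset.mem_of_mem_erase hw) (Finset.ne_of_mem_erase hw).symm a h
      -- The merged vector has length `‖b‖ + ‖p i‖`. As `|⟨u, ·⟩|` is even and homogeneous, both
      -- sums are preserved even when `c < 0`.
      have hmem : (1 + |c|) • b ∉ t.erase b := fun h => hnot _ h _ rfl
      refine ⟨insert ((1 + |c|) • b) (t.erase b), ?_, ?_, ?_, ?_⟩
      · intro w hw
        rcases Finset.mem_insert.1 hw with rfl | hw
        · exact smul_ne_zero hpos.ne' (h0 b hbt)
        · exact h0 w (Finset.mem_of_mem_erase hw)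
      · intro w hw w' hw' hne a h
        rcases Finset.mem_insert.1 hw with rfl | hw <;>
          rcases Finset.mem_insert.1 hw' with rfl | hw'
        · exact hne rfl
        · exact hnot w' hw' (a * (1 + |c|)) (by rw [h, smul_smul])
        · refine hpar w (Finset.mem_of_mem_erase hw) b hbt (Finset.ne_of_mem_erase hw)
            ((1 + |c|)⁻¹ * a) ?_
          rw [mul_smul, ← h, smul_smul, inv_mul_cancel₀ hpos.ne', one_smul]
        · exact hpar w (Finset.mem_of_mem_erase hw) w' (Finset.mem_of_mem_erase hw') hne a h
      · intro u
        rw [Finset.sum_insert hmem, ← hin u, ← Finset.add_sum_erase t _ hbt, hc, inner_smul_right,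
          inner_smul_right, abs_mul, abs_mul, abs_of_pos hpos]
        ring
      · rw [Finset.sum_insert hmem, ← hnorm, ← Finset.add_sum_erase t _ hbt, hc, norm_smul,
          norm_smul, Real.norm_eq_abs, Real.norm_eq_abs, abs_of_pos hpos]
        ring
    · push Not at hb
      have hmem : p i ∉ t := fun h => hb _ h 1 (one_smul _ _).symm
      refine ⟨insert (p i) t, ?_, ?_, ?_, ?_⟩
      · intro w hw
        rcases Finset.mem_insert.1 hw with rfl | hw
        exacts [ha, h0 w hw]
      · intro w hw w' hw' hne a h
        rcases Finset.mem_insert.1 hw with rfl | hw <;>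
          rcases Finset.mem_insert.1 hw' with rfl | hw'
        · exact hne rfl
        · have ha0 : a ≠ 0 := by
            rintro rfl
            exact h0 w' hw' (by rw [h, zero_smul])
          exact hb w' hw' a⁻¹ (by rw [h, smul_smul, inv_mul_cancel₀ ha0, one_smul])
        · exact hb w hw a h
        · exact hpar w hw w' hw' hne a h
      · intro u
        rw [Finset.sum_insert hmem, hin u]
      · rw [Finset.sum_insert hmem, hnorm]

/-- A simple function `F` within `ε` of the identity in `L¹` of the ball supplies the points as its
values and the weights as the measures of its fibres. Replacing `x` by `F x` changes the two
integrals by at most `ε * ‖u‖` and `ε`. -/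
theorem exists_discretization {n : ℕ} (hn : n ≠ 0) {ε : ℝ} (hε : 0 < ε) :
    ∃ (s : Finset (EuclideanSpace ℝ (Fin (n + 1)))) (m : EuclideanSpace ℝ (Fin (n + 1)) → ℝ),
      (∀ x, 0 ≤ m x) ∧
      (∀ u, ∑ x ∈ s, m x * |inner ℝ u x| ≤ (2 * unitBallVolume n / (n + 2) + ε) * ‖u‖) ∧
      (n + 1) * unitBallVolume (n + 1) / (n + 2) - ε ≤ ∑ x ∈ s, m x * ‖x‖ := by
  set μ := (volume : Measure (EuclideanSpace ℝ (Fin (n + 1)))).restrict (closedBall 0 1)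
  have hid : Integrable (fun x : EuclideanSpace ℝ (Fin (n + 1)) => x) μ :=
    continuous_id.continuousOn.integrableOn_compact (isCompact_closedBall _ _)
  obtain ⟨F, hF, hFm⟩ := (memLp_one_iff_integrable.2 hid).exists_simpleFunc_eLpNorm_sub_lt
    ENNReal.one_ne_top (ε := ENNReal.ofReal ε) (by simpa using hε)
  have hFi : Integrable F μ := memLp_one_iff_integrable.1 hFm
  have hd : ∫ x, ‖F x - x‖ ∂μ ≤ ε := by
    rw [eLpNorm_one_eq_lintegral_enorm] at hF
    have h1 : ∫ x, ‖F x - x‖ ∂μ = (∫⁻ x, ‖x - F x‖ₑ ∂μ).toReal := by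
      refine (integral_norm_eq_lintegral_enorm (hFi.sub hid).aestronglyMeasurable).trans ?_
      congr 1
      exact lintegral_congr fun x => enorm_sub_rev _ _
    rw [h1]
    exact ENNReal.toReal_le_of_le_ofReal hε.le hF.le
  have hsum : ∀ g : EuclideanSpace ℝ (Fin (n + 1)) → ℝ, g 0 = 0 → Integrable (fun x => g (F x)) μ →
      ∑ x ∈ F.range, μ.real (F ⁻¹' {x}) * g x = ∫ x, g (F x) ∂μ := by
    intro g hg hgi
    have h1 := SimpleFunc.map_integral (μ := μ) F g hFi hg
    have h2 := SimpleFunc.integral_eq_integral (μ := μ) (F.map g) hgi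
    rw [h1] at h2
    exact h2
  have hdi : Integrable (fun x => ‖F x - x‖) μ := (hFi.sub hid).norm
  refine ⟨F.range, fun x => μ.real (F ⁻¹' {x}), fun x => measureReal_nonneg, fun u => ?_, ?_⟩
  · have hgi : ∀ G : EuclideanSpace ℝ (Fin (n + 1)) → EuclideanSpace ℝ (Fin (n + 1)),
        Integrable G μ → Integrable (fun x => |inner ℝ u (G x)|) μ := fun G hG =>
      (hG.const_inner u).abs
    rw [hsum (fun x => |inner ℝ u x|) (by simp) (hgi _ hFi), add_mul,
      ← setIntegral_closedBall_abs_inner hn u]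
    calc ∫ x, |inner ℝ u (F x)| ∂μ ≤ ∫ x, (|inner ℝ u x| + ‖u‖ * ‖F x - x‖) ∂μ := by
          refine integral_mono (hgi _ hFi) ((hgi _ hid).add (hdi.const_mul _)) fun x => ?_
          have h1 := abs_real_inner_le_norm u (F x - x)
          have h2 : inner ℝ u (F x) = inner ℝ u x + inner ℝ u (F x - x) := by
            rw [← inner_add_right, add_sub_cancel]
          change |inner ℝ u (F x)| ≤ _
          rw [h2]
          exact (abs_add_le _ _).trans (by gcongr)
      _ = ∫ x, |inner ℝ u x| ∂μ + ‖u‖ * ∫ x, ‖F x - x‖ ∂μ := by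
          rw [integral_add (hgi _ hid) (hdi.const_mul _), integral_const_mul]
      _ ≤ _ := by
          rw [mul_comm ε]
          gcongr
  · rw [hsum (fun x => ‖x‖) norm_zero hFi.norm]
    have h1 := setIntegral_closedBall_norm_pow (n + 1) 1 n.succ_ne_zero
    have h2 : ((n + 1 : ℕ) : ℝ) * unitBallVolume (n + 1) / ((n + 1 : ℕ) + (1 : ℕ)) =
        (n + 1) * unitBallVolume (n + 1) / (n + 2) := by
      push_cast
      ring
    rw [h2] at h1
    simp only [pow_one] at h1
    rw [← h1, sub_le_iff_le_add]
    calc ∫ x, ‖x‖ ∂μ ≤ ∫ x, (‖F x‖ + ‖F x - x‖) ∂μ := by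
          refine integral_mono hid.norm (hFi.norm.add hdi) fun x => ?_
          have := norm_sub_norm_le x (F x)
          rw [norm_sub_rev] at this
          change ‖x‖ ≤ ‖F x‖ + ‖F x - x‖
          linarith
      _ = ∫ x, ‖F x‖ ∂μ + ∫ x, ‖F x - x‖ ∂μ := integral_add hFi.norm hdi
      _ ≤ _ := by gcongr

/-- There are zonotopes in the unit ball of `ℝ^(n + 1)` whose total edge length is nearly maximal,
and whose edges are pairwise non-parallel. -/
theorem exists_zonotope {n : ℕ} (hn : n ≠ 0) {a : ℝ}
    (ha : a < (n + 1) / 2 * (unitBallVolume (n + 1) / unitBallVolume n)) :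
    ∃ s : Finset (EuclideanSpace ℝ (Fin (n + 1))), (∀ w ∈ s, w ≠ 0) ∧
      (∀ w ∈ s, ∀ w' ∈ s, w ≠ w' → ∀ c : ℝ, w' ≠ c • w) ∧
      (∀ u, ∑ w ∈ s, |inner ℝ u w| ≤ ‖u‖) ∧ a < ∑ w ∈ s, ‖w‖ := by
  have hω := unitBallVolume_pos n
  set c := 2 * unitBallVolume n / (n + 2) with hc
  set J := (n + 1) * unitBallVolume (n + 1) / (n + 2) with hJ
  have hc0 : 0 < c := by positivity
  have hlim : Tendsto (fun ε : ℝ => (J - ε) / (c + ε)) (nhdsWithin 0 (Ioi 0)) (nhds (J / c)) := by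
    refine tendsto_nhdsWithin_of_tendsto_nhds ?_
    have : ContinuousAt (fun ε : ℝ => (J - ε) / (c + ε)) 0 :=
      ContinuousAt.div (by fun_prop) (by fun_prop) (by simpa using hc0.ne')
    simpa [ContinuousAt] using this
  have hJc : J / c = (n + 1) / 2 * (unitBallVolume (n + 1) / unitBallVolume n) := by
    rw [hJ, hc]
    field_simp
  rw [← hJc] at ha
  obtain ⟨ε, hεa, hε⟩ := ((hlim.eventually_const_lt ha).and self_mem_nhdsWithin).exists
  replace hε : 0 < ε := hε
  obtain ⟨t, m, hm, hin, hnorm⟩ := exists_discretization hn hε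
  have hcε : 0 < c + ε := by positivity
  obtain ⟨s, h0, hpar, hsin, hsnorm⟩ :=
    -- Division by `c + ε` brings the zonotope into the unit ball and leaves edge sum at least `(J -
    -- ε) / (c + ε)`.
    exists_nonparallel_finset t fun x => (m x / (c + ε)) • x
  refine ⟨s, h0, hpar, fun u => ?_, ?_⟩
  · rw [hsin]
    have h1 : ∀ x, |inner ℝ u ((m x / (c + ε)) • x)| = m x * |inner ℝ u x| / (c + ε) := fun x => by
      rw [inner_smul_right, abs_mul, abs_of_nonneg (div_nonneg (hm x) hcε.le)]
      ring
    simp only [h1]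
    rw [← Finset.sum_div, div_le_iff₀ hcε, mul_comm ‖u‖]
    exact hin u
  · rw [hsnorm]
    have h1 : ∀ x, ‖(m x / (c + ε)) • x‖ = m x * ‖x‖ / (c + ε) := fun x => by
      rw [norm_smul, Real.norm_of_nonneg (div_nonneg (hm x) hcε.le)]
      ring
    simp only [h1]
    rw [← Finset.sum_div]
    exact hεa.trans_le (by gcongr)

/-! ### Separated hyperplane pieces and their regularity. -/

/-- The part of the zero set of `cos 2π⟨x, w⟩` that stays away from the zero sets of the other
factors `cos 2π⟨x, w'⟩`, `w' ∈ s`. -/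
def gridPiece {d : ℕ} (s : Finset (EuclideanSpace ℝ (Fin d))) (η : ℝ)
    (w : EuclideanSpace ℝ (Fin d)) : Set (EuclideanSpace ℝ (Fin d)) :=
  {x | Real.cos (2 * Real.pi * inner ℝ x w) = 0 ∧
    ∀ w' ∈ s, w' ≠ w → η ≤ |Real.cos (2 * Real.pi * inner ℝ x w')|}

/-- A union of separated pieces of hyperplanes in the zero set of `cosProd s`. -/
def gridUnion {d : ℕ} (s : Finset (EuclideanSpace ℝ (Fin d))) (η : ℝ) :
    Set (EuclideanSpace ℝ (Fin d)) :=
  ⋃ w ∈ s, gridPiece s η w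

theorem isClosed_gridPiece {d : ℕ} (s : Finset (EuclideanSpace ℝ (Fin d))) (η : ℝ)
    (w : EuclideanSpace ℝ (Fin d)) : IsClosed (gridPiece s η w) := by
  have h : gridPiece s η w = {x | Real.cos (2 * Real.pi * inner ℝ x w) = 0} ∩
      ⋂ w' ∈ s, ⋂ _ : w' ≠ w, {x | η ≤ |Real.cos (2 * Real.pi * inner ℝ x w')|} := by
    ext x
    simp [gridPiece]
  rw [h]
  refine (isClosed_eq (by fun_prop) continuous_const).inter ?_
  exact isClosed_biInter fun w' _ => isClosed_iInter fun _ =>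
    isClosed_le continuous_const (by fun_prop)

theorem isClosed_gridUnion {d : ℕ} (s : Finset (EuclideanSpace ℝ (Fin d))) (η : ℝ) :
    IsClosed (gridUnion s η) :=
  s.finite_toSet.isClosed_biUnion fun w _ => isClosed_gridPiece s η w

theorem gridUnion_subset_zeros {d : ℕ} (s : Finset (EuclideanSpace ℝ (Fin d))) (η : ℝ) :
    gridUnion s η ⊆ {x | cosProd s x = 0} := by
  intro x hx
  obtain ⟨w, hw, hxw⟩ := mem_iUnion₂.1 hx
  rw [mem_ofPred_eq, cosProd, Finset.prod_eq_zero hw hxw.1, Complex.ofReal_zero]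

theorem eq_of_cos_eq_zero_of_abs_sub_lt {a b : ℝ} (ha : Real.cos (2 * Real.pi * a) = 0)
    (hb : Real.cos (2 * Real.pi * b) = 0) (hab : |a - b| < 1 / 2) : a = b := by
  obtain ⟨k, hk⟩ := Real.cos_eq_zero_iff.1 ha
  obtain ⟨l, hl⟩ := Real.cos_eq_zero_iff.1 hb
  have h : ∀ (c : ℝ) (m : ℤ), 2 * Real.pi * c = (2 * m + 1) * Real.pi / 2 →
      c = (2 * m + 1) / 4 := fun c m hm => by
    have := Real.pi_pos.ne'
    field_simp at hm
    linarith
  rw [h a k hk, h b l hl] at hab ⊢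
  have h1 : |((k - l : ℤ) : ℝ)| < 1 := by
    push_cast
    rw [abs_lt] at hab ⊢
    constructor <;> linarith [hab.1, hab.2]
  have h2 : k - l = 0 := Int.abs_lt_one_iff.1 (by exact_mod_cast h1)
  rw [sub_eq_zero.1 h2]

/-- A small ball meets only one of the hyperplane pieces. -/
theorem exists_gridUnion_inter_closedBall_subset {d : ℕ} (s : Finset (EuclideanSpace ℝ (Fin d)))
    {η : ℝ} (hη : 0 < η) :
    ∃ τ > 0, ∀ x, ∀ r ≤ τ, (gridUnion s η ∩ closedBall x r).Nonempty → ∃ w ∈ s, ∃ c : ℝ,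
      (∀ y ∈ gridUnion s η ∩ closedBall x r, inner ℝ y w = c) ∧
      ∀ w' ∈ s, w' ≠ w → gridPiece s η w' ∩ closedBall x r = ∅ := by
  set L := 1 + ∑ w ∈ s, ‖w‖ with hL
  have hL0 : 0 < L := by positivity
  have hle : ∀ w ∈ s, ‖w‖ ≤ L := fun w hw => by
    have := Finset.single_le_sum (f := fun w => ‖w‖) (fun i _ => norm_nonneg i) hw
    linarith
  -- On a ball of radius `τ` each `⟨·, w⟩` varies by at most `min η 1 / 8`. Hence `cos 2π⟨·, w⟩`
  -- varies by at most `(π / 4) * min η 1 < η`, and `⟨·, w⟩` by less than `1 / 2`, the gap between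
  -- zeros.
  set τ := min η 1 / (16 * L) with hτ
  have hτ0 : 0 < τ := by positivity
  have hτL : 16 * (τ * L) = min η 1 := by
    rw [hτ]
    field_simp
  refine ⟨τ, hτ0, fun x r hr => ?_⟩
  have hin : ∀ y z, y ∈ closedBall x r → z ∈ closedBall x r → ∀ w ∈ s,
      |inner ℝ y w - inner ℝ z w| ≤ min η 1 / 8 := by
    intro y z hy hz w hw
    rw [← inner_sub_left]
    have h1 : ‖y - z‖ ≤ 2 * τ := by
      rw [← dist_eq_norm]
      linarith [dist_triangle_right y z x, mem_closedBall.1 hy, mem_closedBall.1 hz]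
    calc |inner ℝ (y - z) w| ≤ ‖y - z‖ * ‖w‖ := abs_real_inner_le_norm _ _
      _ ≤ (2 * τ) * L := by
          gcongr
          exact hle w hw
      _ = min η 1 / 8 := by linarith
  have hdis : ∀ w ∈ s, ∀ w' ∈ s, w' ≠ w → ∀ y ∈ gridPiece s η w ∩ closedBall x r,
      gridPiece s η w' ∩ closedBall x r = ∅ := by
    intro w hw w' hw' hne y hy
    refine eq_empty_of_forall_notMem fun z hz => ?_
    have h1 := hy.1.2 w' hw' hne
    have h2 := Real.abs_cos_sub_cos_le (2 * Real.pi * inner ℝ y w') (2 * Real.pi * inner ℝ z w')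
    rw [hz.1.1, sub_zero, ← mul_sub, abs_mul, abs_of_pos Real.two_pi_pos] at h2
    have h3 := hin y z hy.2 hz.2 w' hw'
    have h4 := Real.pi_lt_four
    have h5 := mul_le_mul_of_nonneg_left h3 Real.two_pi_pos.le
    have h6 : 0 < min η 1 := by positivity
    nlinarith [min_le_left η 1]
  rintro ⟨y, hy, hyx⟩
  obtain ⟨w, hw, hyw⟩ := mem_iUnion₂.1 hy
  refine ⟨w, hw, inner ℝ y w, fun z hz => ?_, fun w' hw' hne => hdis w hw w' hw' hne y ⟨hyw, hyx⟩⟩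
  obtain ⟨w', hw', hzw⟩ := mem_iUnion₂.1 hz.1
  by_cases hne : w' = w
  · subst hne
    refine eq_of_cos_eq_zero_of_abs_sub_lt hzw.1 hyw.1 ?_
    linarith [hin z y hz.2 hyx w' hw', min_le_right η 1]
  · have := hdis w hw w' hw' hne y ⟨hyw, hyx⟩
    exact (eq_empty_iff_forall_notMem.1 this z ⟨hzw, hz.2⟩).elim

/-- A closed set that is locally contained in hyperplanes at some uniform scale is `φ`-regular for
a function `φ` with `φ 0 = 1`. -/
theorem exists_isPhiRegular {n : ℕ} {Γ : Set (EuclideanSpace ℝ (Fin (n + 1)))} (hΓ : IsClosed Γ)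
    {τ : ℝ} (hτ : 0 < τ)
    (h : ∀ x, ∀ r ≤ τ, ∃ w : EuclideanSpace ℝ (Fin (n + 1)), w ≠ 0 ∧ ∃ c : ℝ,
      ∀ y ∈ Γ ∩ closedBall x r, inner ℝ y w = c) :
    ∃ φ : ℝ → ℝ, φ 0 = 1 ∧ IsPhiRegular φ Γ := by
  have hsmall : ∀ x, ∀ r, 0 ≤ r → r ≤ τ → hausdorffSurfaceMeasure n (Γ ∩ closedBall x r) ≤
      ENNReal.ofReal (unitBallVolume n) * ENNReal.ofReal r ^ n := by
    intro x r hr hrτ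
    obtain ⟨w, hw, c, hc⟩ := h x r hrτ
    refine (hausdorffSurfaceMeasure_mono fun y hy => ?_).trans
      (hausdorffSurfaceMeasure_hyperplane_inter_closedBall_le hw c x hr)
    exact ⟨hc y hy, hy.2⟩
  obtain ⟨t, -, htf, htc⟩ := finite_cover_balls_of_compact
    (isCompact_closedBall (0 : EuclideanSpace ℝ (Fin (n + 1))) 1) hτ
  set N := htf.toFinset.card
  -- `N` balls of radius `τ` cover a unit ball, so for `τ ≤ r < 1` the mass is at most `N ω_n τ ^ n
  -- ≤ N ω_n r ^ n`.
  refine ⟨fun r => if r < τ then 1 else N, by simp [hτ], ?_, ?_, hΓ, ?_⟩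
  · intro r _
    split_ifs <;> positivity
  · refine ContinuousAt.continuousWithinAt ?_
    refine continuousAt_const.congr (f := fun _ => (1 : ℝ)) ?_
    filter_upwards [Iio_mem_nhds hτ] with r hr
    exact (if_pos hr).symm
  · intro x r hr
    rw [inter_comm, Nat.add_sub_cancel]
    split_ifs with hrτ
    · refine (hsmall x r hr.1.le hrτ.le).trans_eq ?_
      rw [one_mul, ENNReal.ofReal_mul (unitBallVolume_pos n).le, ENNReal.ofReal_pow hr.1.le]
    · have hcov : Γ ∩ closedBall x r ⊆ ⋃ z ∈ htf.toFinset, Γ ∩ closedBall (x + z) τ := by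
        rintro y ⟨hy, hyx⟩
        have h1 : y - x ∈ closedBall (0 : EuclideanSpace ℝ (Fin (n + 1))) 1 := by
          rw [mem_closedBall_zero_iff, ← dist_eq_norm]
          exact (mem_closedBall.1 hyx).trans hr.2.le
        obtain ⟨z, hz, hyz⟩ := mem_iUnion₂.1 (htc h1)
        refine mem_iUnion₂.2 ⟨z, htf.mem_toFinset.2 hz, hy, ?_⟩
        rw [mem_ball, dist_eq_norm] at hyz
        rw [mem_closedBall, dist_eq_norm, ← sub_sub]
        exact hyz.le
      refine (hausdorffSurfaceMeasure_mono hcov).trans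
        ((hausdorffSurfaceMeasure_biUnion_le _ _).trans ?_)
      refine (Finset.sum_le_sum fun z _ => hsmall (x + z) τ hτ.le le_rfl).trans ?_
      have hω := unitBallVolume_pos n
      rw [Finset.sum_const, nsmul_eq_mul, ← ENNReal.ofReal_pow hτ.le, ← ENNReal.ofReal_mul hω.le,
        ← ENNReal.ofReal_natCast, ← ENNReal.ofReal_mul (Nat.cast_nonneg _), ← mul_assoc]
      refine ENNReal.ofReal_le_ofReal ?_
      gcongr
      exact not_lt.1 hrτ

/-! ### Lower bound for the surface density of the pieces. -/

theorem gridMeasure_cos_ne_zero {n : ℕ} {w : EuclideanSpace ℝ (Fin (n + 1))} (hw : w ≠ 0) :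
    gridMeasure w {x | Real.cos (2 * Real.pi * inner ℝ x w) ≠ 0} = 0 := by
  have hm : MeasurableSet {x | Real.cos (2 * Real.pi * inner ℝ x w) ≠ 0} :=
    (isClosed_eq (by fun_prop) continuous_const).measurableSet.compl
  rw [gridMeasure_apply w hm]
  refine ENNReal.tsum_eq_zero.2 fun k => ?_
  convert measure_empty (μ := volume)
  refine eq_empty_of_forall_notMem fun y hy => hy ?_
  rw [inner_hyperplaneChart, mul_div_cancel₀ _ (norm_ne_zero_iff.2 hw)]
  exact Real.cos_eq_zero_iff.2 ⟨k, by ring⟩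

/-- A ball of radius at most `τ` meets one hyperplane piece at most, so the sum of the restricted
grid measures gives it at most `ω_n r ^ n`, and the mass distribution principle applies. -/
theorem sum_gridMeasure_le_hausdorffSurfaceMeasure {n : ℕ}
    (s : Finset (EuclideanSpace ℝ (Fin (n + 1)))) (hs : ∀ w ∈ s, w ≠ 0) {η : ℝ} (hη : 0 < η)
    (x : EuclideanSpace ℝ (Fin (n + 1))) (R : ℝ) :
    ∑ w ∈ s, gridMeasure w (gridPiece s η w ∩ closedBall x R) ≤
      hausdorffSurfaceMeasure n (gridUnion s η ∩ closedBall x R) := by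
  classical
  set μ := ∑ w ∈ s, (gridMeasure w).restrict (gridPiece s η w)
  have hμ : ∀ S, MeasurableSet S → μ S = ∑ w ∈ s, gridMeasure w (gridPiece s η w ∩ S) :=
    fun S hS => by
      rw [Measure.finsetSum_apply]
      exact Finset.sum_congr rfl fun w _ => by rw [Measure.restrict_apply hS, inter_comm]
  obtain ⟨τ, hτ, hloc⟩ := exists_gridUnion_inter_closedBall_subset s hη
  have hsub : ∀ w ∈ s, gridPiece s η w ⊆ gridUnion s η := fun w hw =>
    subset_biUnion_of_mem (u := fun w => gridPiece s η w) hw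
  have hball : ∀ x, ∀ r, 0 < r → r ≤ τ → μ (closedBall x r) ≤
      ENNReal.ofReal (unitBallVolume n) * ENNReal.ofReal r ^ n := by
    intro x r hr hrτ
    rw [hμ _ measurableSet_closedBall]
    by_cases hne : (gridUnion s η ∩ closedBall x r).Nonempty
    · obtain ⟨w, hw, c, hc, hempty⟩ := hloc x r hrτ hne
      rw [Finset.sum_eq_single_of_mem w hw fun w' hw' hne' => by
        rw [hempty w' hw' hne', measure_empty]]
      exact gridMeasure_le_of_subset_hyperplane (hs w hw) x hr.le
        ((isClosed_gridPiece s η w).inter isClosed_closedBall).measurableSet inter_subset_right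
        fun y hy => hc y ⟨hsub w hw hy.1, hy.2⟩
    · rw [Finset.sum_eq_zero fun w hw => ?_]
      · exact zero_le
      · have : gridPiece s η w ∩ closedBall x r = ∅ := subset_empty_iff.1 fun y hy =>
          hne ⟨y, hsub w hw hy.1, hy.2⟩
        rw [this, measure_empty]
  refine le_trans ?_ (measure_le_hausdorffSurfaceMeasure μ hτ hball _)
  rw [hμ _ ((isClosed_gridUnion s η).inter isClosed_closedBall).measurableSet]
  exact Finset.sum_le_sum fun w hw => measure_mono fun y hy => ⟨hy.1, hsub w hw hy.1, hy.2⟩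

theorem eventually_le_sin (M : ℕ) :
    ∀ᶠ η : ℝ in nhdsWithin 0 (Ioi 0), ∀ j ∈ Finset.Ioo 0 M,
      2 * η ≤ Real.sin (j * Real.pi / M) := by
  rw [eventually_all_finset]
  intro j hj
  obtain ⟨hj0, hjM⟩ := Finset.mem_Ioo.1 hj
  have hM : (0 : ℝ) < M := by exact_mod_cast hj0.trans hjM
  have hpos : 0 < Real.sin (j * Real.pi / M) := by
    refine Real.sin_pos_of_pos_of_lt_pi ?_ ?_
    · have : (0 : ℝ) < j := by exact_mod_cast hj0
      positivity
    · rw [div_lt_iff₀ hM, mul_comm]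
      have : (j : ℝ) < M := by exact_mod_cast hjM
      gcongr
  have : Tendsto (fun η : ℝ => 2 * η) (nhdsWithin 0 (Ioi 0)) (nhds 0) := by
    refine tendsto_nhdsWithin_of_tendsto_nhds ?_
    simpa using (continuous_const_mul (2 : ℝ)).tendsto 0
  exact (this.eventually_lt_const hpos).mono fun _ h => h.le

theorem abs_sin_sub_le_abs_cos_add_abs_cos (a b : ℝ) :
    |Real.sin (a - b)| ≤ |Real.cos a| + |Real.cos b| := by
  rw [Real.sin_sub]
  refine (abs_sub _ _).trans ?_
  rw [abs_mul, abs_mul, add_comm]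
  exact add_le_add (mul_le_of_le_one_right (abs_nonneg _) (Real.abs_sin_le_one _))
    (mul_le_of_le_one_left (abs_nonneg _) (Real.abs_sin_le_one _))

/-- The zero set of `cos 2π⟨x, w⟩` meets a thin neighbourhood of the zero set of `cos 2π⟨x, w'⟩`
in a set of small density, since many translates of the intersection are disjoint. -/
theorem eventually_gridMeasure_abs_cos_lt_le {n : ℕ} {w w' : EuclideanSpace ℝ (Fin (n + 1))}
    (hw : w ≠ 0) (hww' : ∀ c : ℝ, w' ≠ c • w) :
    ∀ᶠ S : ℝ in atTop, ∀ M : ℕ, ∀ᶠ η : ℝ in nhdsWithin 0 (Ioi 0), ∀ x R,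
      M * gridMeasure w ({y | |Real.cos (2 * Real.pi * inner ℝ y w')| < η} ∩ closedBall x R) ≤
        gridMeasure w (closedBall x (R + S)) := by
  -- `q` is a multiple of the component of `w'` orthogonal to `w`, nonzero as the vectors are not
  -- parallel. Translation by `q` preserves the grid of `w` and shifts the phase `2π⟨·, w'⟩` by `π`,
  -- one period of `|cos|`.
  obtain ⟨q, hqw, hqw'⟩ : ∃ q : EuclideanSpace ℝ (Fin (n + 1)),
      inner ℝ q w = 0 ∧ inner ℝ q w' = 1 / 2 := by
    set c := inner ℝ w' w / ‖w‖ ^ 2 with hc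
    have hv : w' - c • w ≠ 0 := fun h => hww' c (sub_eq_zero.1 h)
    have hvw : inner ℝ (w' - c • w) w = 0 := by
      rw [inner_sub_left, real_inner_smul_left, real_inner_self_eq_norm_sq, hc,
        div_mul_cancel₀ _ (pow_ne_zero 2 (norm_ne_zero_iff.2 hw)), sub_self]
    refine ⟨(1 / (2 * ‖w' - c • w‖ ^ 2)) • (w' - c • w), ?_, ?_⟩
    · rw [real_inner_smul_left, hvw, mul_zero]
    · have h1 : inner ℝ (w' - c • w) w' = ‖w' - c • w‖ ^ 2 := by
        rw [← real_inner_self_eq_norm_sq]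
        conv_rhs => rw [inner_sub_right, real_inner_smul_right, hvw, mul_zero, sub_zero]
      rw [real_inner_smul_left, h1]
      have := norm_ne_zero_iff.2 hv
      field_simp
  filter_upwards [eventually_ge_atTop ‖q‖] with S hS M
  filter_upwards [eventually_le_sin M] with η hη x R
  set A := {y | |Real.cos (2 * Real.pi * inner ℝ y w')| < η} ∩ closedBall x R with hA
  have hAm : MeasurableSet A :=
    (isOpen_lt (by fun_prop) continuous_const).measurableSet.inter measurableSet_closedBall
  set B : ℕ → Set (EuclideanSpace ℝ (Fin (n + 1))) := fun m =>
    (· + ((m : ℝ) / M) • q) ⁻¹' A with hB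
  have hBA : ∀ m, gridMeasure w (B m) = gridMeasure w A := fun m =>
    gridMeasure_preimage_add_right hw (by rw [real_inner_smul_left, hqw, mul_zero]) hAm
  -- A common point would have two phases differing by `(j - i)π / M`, both with `|cos| < η`. The
  -- sine of the difference would then be below `2 * η`, against the choice of `η`.
  have hdisj : ∀ i ∈ Finset.range M, ∀ j ∈ Finset.range M, i < j → Disjoint (B i) (B j) := by
    intro i _ j hj hij
    refine disjoint_left.2 fun y hyi hyj => ?_
    have hj' := Finset.mem_range.1 hj
    have hM : (M : ℝ) ≠ 0 := by
      have : M ≠ 0 := by omega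
      exact_mod_cast this
    have h1 : |Real.cos (2 * Real.pi * inner ℝ (y + ((i : ℝ) / M) • q) w')| < η := hyi.1
    have h2 : |Real.cos (2 * Real.pi * inner ℝ (y + ((j : ℝ) / M) • q) w')| < η := hyj.1
    have h3 := abs_sin_sub_le_abs_cos_add_abs_cos
      (2 * Real.pi * inner ℝ (y + ((j : ℝ) / M) • q) w')
      (2 * Real.pi * inner ℝ (y + ((i : ℝ) / M) • q) w')
    have h4 : 2 * Real.pi * inner ℝ (y + ((j : ℝ) / M) • q) w' -
        2 * Real.pi * inner ℝ (y + ((i : ℝ) / M) • q) w' = ((j - i : ℕ) : ℝ) * Real.pi / M := by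
      rw [inner_add_left, inner_add_left, real_inner_smul_left, real_inner_smul_left, hqw',
        Nat.cast_sub hij.le]
      field_simp
      ring
    rw [h4] at h3
    have h5 := hη (j - i) (Finset.mem_Ioo.2 ⟨by omega, by omega⟩)
    linarith [le_abs_self (Real.sin (((j - i : ℕ) : ℝ) * Real.pi / M))]
  have hsub : (⋃ m ∈ Finset.range M, B m) ⊆ closedBall x (R + S) := by
    refine iUnion₂_subset fun m hm y hy => ?_
    have h1 : dist (y + ((m : ℝ) / M) • q) x ≤ R := hy.2
    have h2 : dist y (y + ((m : ℝ) / M) • q) ≤ ‖q‖ := by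
      rw [dist_self_add_right, norm_smul, Real.norm_of_nonneg (by positivity)]
      refine mul_le_of_le_one_left (norm_nonneg _) (div_le_one_of_le₀ ?_ (by positivity))
      exact_mod_cast (Finset.mem_range.1 hm).le
    rw [mem_closedBall]
    linarith [dist_triangle y (y + ((m : ℝ) / M) • q) x]
  calc (M : ℝ≥0∞) * gridMeasure w A = ∑ m ∈ Finset.range M, gridMeasure w (B m) := by
        simp [hBA]
    _ = gridMeasure w (⋃ m ∈ Finset.range M, B m) := by
        rw [measure_biUnion_finset]
        · intro i hi j hj hij
          rcases lt_or_gt_of_ne hij with h | h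
          exacts [hdisj i hi j hj h, (hdisj j hj i hi h).symm]
        · exact fun m _ => measurable_add_const _ hAm
    _ ≤ gridMeasure w (closedBall x (R + S)) := measure_mono hsub

theorem gridMeasure_closedBall_le_gridPiece_add {n : ℕ}
    (s : Finset (EuclideanSpace ℝ (Fin (n + 1)))) (η : ℝ) {w : EuclideanSpace ℝ (Fin (n + 1))}
    (hw : w ≠ 0) (x : EuclideanSpace ℝ (Fin (n + 1))) (R : ℝ) :
    gridMeasure w (closedBall x R) ≤ gridMeasure w (gridPiece s η w ∩ closedBall x R) +
      ∑ w' ∈ s with w' ≠ w, gridMeasure w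
        ({y | |Real.cos (2 * Real.pi * inner ℝ y w')| < η} ∩ closedBall x R) := by
  have hsub : closedBall x R ⊆ {y | Real.cos (2 * Real.pi * inner ℝ y w) ≠ 0} ∪
      (gridPiece s η w ∩ closedBall x R ∪ ⋃ w' ∈ s.filter (· ≠ w),
        {y | |Real.cos (2 * Real.pi * inner ℝ y w')| < η} ∩ closedBall x R) := by
    intro y hy
    by_cases h0 : Real.cos (2 * Real.pi * inner ℝ y w) = 0
    · by_cases h1 : ∀ w' ∈ s, w' ≠ w → η ≤ |Real.cos (2 * Real.pi * inner ℝ y w')|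
      · exact Or.inr (Or.inl ⟨⟨h0, h1⟩, hy⟩)
      · push Not at h1
        obtain ⟨w', hw', hne, hlt⟩ := h1
        exact Or.inr (Or.inr (mem_iUnion₂.2 ⟨w', Finset.mem_filter.2 ⟨hw', hne⟩, hlt, hy⟩))
    · exact Or.inl h0
  refine (measure_mono hsub).trans ((measure_union_le _ _).trans ?_)
  rw [gridMeasure_cos_ne_zero hw, zero_add]
  exact (measure_union_le _ _).trans (add_le_add le_rfl (measure_biUnion_finset_le _ _))

/-- Each of the fewer than `s.card` other factors costs a piece at most a fraction of about `1 / M`.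
The margin `a` is fixed before `M`, and `η` after it; multiplying through by `M` avoids division in
`ℝ≥0∞`. -/
theorem exists_gridUnion_lower_bound {n : ℕ} (s : Finset (EuclideanSpace ℝ (Fin (n + 1))))
    (hs : ∀ w ∈ s, w ≠ 0) (hpar : ∀ w ∈ s, ∀ w' ∈ s, w ≠ w' → ∀ c : ℝ, w' ≠ c • w) :
    ∃ a : ℝ, ∀ M : ℕ, ∃ η > 0, ∀ x R,
      M * (ENNReal.ofReal (∑ w ∈ s, 2 * ‖w‖) * volume (closedBall x (R - a))) ≤
        M * hausdorffSurfaceMeasure n (gridUnion s η ∩ closedBall x R) +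
        s.card * (ENNReal.ofReal (∑ w ∈ s, 2 * ‖w‖) * volume (closedBall x (R + a))) := by
  have hS : ∀ᶠ S : ℝ in atTop, ∀ w ∈ s, ∀ w' ∈ s, w' ≠ w → ∀ M : ℕ,
      ∀ᶠ η : ℝ in nhdsWithin 0 (Ioi 0), ∀ x R, M * gridMeasure w
        ({y | |Real.cos (2 * Real.pi * inner ℝ y w')| < η} ∩ closedBall x R) ≤
          gridMeasure w (closedBall x (R + S)) := by
    rw [eventually_all_finset]
    intro w hw
    rw [eventually_all_finset]
    intro w' hw'
    rw [eventually_imp_distrib_left]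
    exact fun hne => eventually_gridMeasure_abs_cos_lt_le (hs w hw) (hpar w hw w' hw' hne.symm)
  obtain ⟨S, hS, hS0⟩ := (hS.and (eventually_ge_atTop 0)).exists
  set a := S + ∑ w ∈ s, 1 / (2 * ‖w‖) with ha
  have haw : ∀ w ∈ s, S + 1 / (2 * ‖w‖) ≤ a := fun w hw => by
    have := Finset.single_le_sum (f := fun w => 1 / (2 * ‖w‖)) (fun i _ => by positivity) hw
    linarith
  refine ⟨a, fun M => ?_⟩
  have hη : ∀ᶠ η : ℝ in nhdsWithin 0 (Ioi 0), ∀ w ∈ s, ∀ w' ∈ s, w' ≠ w → ∀ x R,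
      M * gridMeasure w
        ({y | |Real.cos (2 * Real.pi * inner ℝ y w')| < η} ∩ closedBall x R) ≤
          gridMeasure w (closedBall x (R + S)) := by
    rw [eventually_all_finset]
    intro w hw
    rw [eventually_all_finset]
    intro w' hw'
    rw [eventually_imp_distrib_left]
    exact fun hne => hS w hw w' hw' hne M
  obtain ⟨η, hη, hη0⟩ := (hη.and self_mem_nhdsWithin).exists
  refine ⟨η, hη0, fun x R => ?_⟩
  have hinv : ∀ w ∈ s, ENNReal.ofReal (2 * ‖w‖) * ENNReal.ofReal (1 / (2 * ‖w‖)) = 1 :=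
    fun w hw => by
      have := norm_pos_iff.2 (hs w hw)
      rw [← ENNReal.ofReal_mul (by positivity), mul_one_div_cancel (by positivity),
        ENNReal.ofReal_one]
  have hlow : ∀ w ∈ s, ENNReal.ofReal (2 * ‖w‖) * volume (closedBall x (R - a)) ≤
      gridMeasure w (closedBall x R) := fun w hw => by
    calc ENNReal.ofReal (2 * ‖w‖) * volume (closedBall x (R - a))
        ≤ ENNReal.ofReal (2 * ‖w‖) *
          (ENNReal.ofReal (1 / (2 * ‖w‖)) * gridMeasure w (closedBall x R)) := by
          gcongr
          refine le_trans (measure_mono (closedBall_subset_closedBall ?_))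
            (volume_closedBall_le_gridMeasure (hs w hw) x R)
          linarith [haw w hw]
      _ = gridMeasure w (closedBall x R) := by rw [← mul_assoc, hinv w hw, one_mul]
  have hup : ∀ w ∈ s, gridMeasure w (closedBall x (R + S)) ≤
      ENNReal.ofReal (2 * ‖w‖) * volume (closedBall x (R + a)) := fun w hw => by
    calc gridMeasure w (closedBall x (R + S)) = ENNReal.ofReal (2 * ‖w‖) *
          (ENNReal.ofReal (1 / (2 * ‖w‖)) * gridMeasure w (closedBall x (R + S))) := by
          rw [← mul_assoc, hinv w hw, one_mul]
      _ ≤ _ := by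
          gcongr
          refine (gridMeasure_closedBall_le (hs w hw) x (R + S)).trans
            (measure_mono (closedBall_subset_closedBall ?_))
          linarith [haw w hw]
  have hone : ∀ w ∈ s, M * (ENNReal.ofReal (2 * ‖w‖) * volume (closedBall x (R - a))) ≤
      M * gridMeasure w (gridPiece s η w ∩ closedBall x R) +
        s.card * (ENNReal.ofReal (2 * ‖w‖) * volume (closedBall x (R + a))) := by
    intro w hw
    refine (mul_le_mul_right ((hlow w hw).trans
      (gridMeasure_closedBall_le_gridPiece_add s η (hs w hw) x R)) _).trans ?_
    rw [mul_add, Finset.mul_sum]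
    gcongr
    calc ∑ w' ∈ s with w' ≠ w, M * gridMeasure w
          ({y | |Real.cos (2 * Real.pi * inner ℝ y w')| < η} ∩ closedBall x R)
        ≤ ∑ w' ∈ s with w' ≠ w, ENNReal.ofReal (2 * ‖w‖) * volume (closedBall x (R + a)) :=
          Finset.sum_le_sum fun w' hw' =>
            (hη w hw w' (Finset.mem_filter.1 hw').1 (Finset.mem_filter.1 hw').2 x R).trans
              (hup w hw)
      _ ≤ _ := by
          rw [Finset.sum_const, nsmul_eq_mul]
          gcongr
          exact Finset.filter_subset _ _
  have hsum := Finset.sum_le_sum hone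
  rw [Finset.sum_add_distrib, ← Finset.mul_sum, ← Finset.mul_sum, ← Finset.mul_sum,
    ← Finset.sum_mul, ← Finset.sum_mul, ← ENNReal.ofReal_sum_of_nonneg fun _ _ => by positivity]
    at hsum
  refine hsum.trans ?_
  gcongr
  exact sum_gridMeasure_le_hausdorffSurfaceMeasure s hs hη0 x R

theorem tendsto_add_pow_div_pow (a : ℝ) (d : ℕ) :
    Tendsto (fun R : ℝ => (R + a) ^ d / R ^ d) atTop (nhds 1) := by
  have h : Tendsto (fun R : ℝ => (1 + a / R) ^ d) atTop (nhds 1) := by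
    have h1 : Tendsto (fun R : ℝ => a / R) atTop (nhds 0) :=
      tendsto_const_nhds.div_atTop tendsto_id
    simpa using (h1.const_add 1).pow d
  refine h.congr' ?_
  filter_upwards [eventually_gt_atTop 0] with R hR
  rw [← div_pow]
  congr 1
  field_simp

/-- Since `(R ± a) ^ d / R ^ d → 1`, the density is asymptotically at least `(1 - C / M) * A`; the
strict inequality in `hb` absorbs the error, uniformly in the centre. -/
theorem le_lowerSurfaceDensity {d : ℕ} {Γ : Set (EuclideanSpace ℝ (Fin d))} {A C a b : ℝ} {M : ℕ}
    (hM : M ≠ 0) (hA : 0 ≤ A) (hC : 0 ≤ C) (hb : M * b < (M - C) * A)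
    (h : ∀ x R, M * (ENNReal.ofReal A * volume (closedBall x (R - a))) ≤
        M * hausdorffSurfaceMeasure (d - 1) (Γ ∩ closedBall x R) +
        ENNReal.ofReal C * (ENNReal.ofReal A * volume (closedBall x (R + a)))) :
    ENNReal.ofReal b ≤ lowerSurfaceDensity Γ := by
  rcases lt_or_ge b 0 with hb0 | hb0
  · rw [ENNReal.ofReal_of_nonpos hb0.le]
    exact zero_le
  have hM0 : (0 : ℝ) < M := by exact_mod_cast Nat.pos_of_ne_zero hM
  have hlim : Tendsto (fun R : ℝ => M * A * ((R + -a) ^ d / R ^ d) -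
      C * A * ((R + a) ^ d / R ^ d)) atTop (nhds ((M - C) * A)) := by
    have := ((tendsto_add_pow_div_pow (-a) d).const_mul (M * A)).sub
      ((tendsto_add_pow_div_pow a d).const_mul (C * A))
    rwa [mul_one, mul_one, ← sub_mul] at this
  refine le_liminf_of_le (by isBoundedDefault) ?_
  filter_upwards [hlim.eventually_const_lt hb, eventually_gt_atTop 0, eventually_ge_atTop |a|]
    with R hR hR0 hRa
  refine le_iInf fun x => ?_
  have hRa1 : 0 ≤ R - a := by linarith [le_abs_self a]
  have hRa2 : 0 ≤ R + a := by linarith [neg_le_abs a]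
  have hRd : 0 < R ^ d := by positivity
  have hreal : M * b * R ^ d + C * A * (R + a) ^ d ≤ M * A * (R - a) ^ d := by
    have h1 := mul_lt_mul_of_pos_right hR hRd
    rw [sub_mul, mul_assoc (M * A), mul_assoc (C * A), div_mul_cancel₀ _ hRd.ne',
      div_mul_cancel₀ _ hRd.ne', ← sub_eq_add_neg] at h1
    linarith
  have hω := unitBallVolume_pos d
  have hV : ∀ r : ℝ, 0 ≤ r → volume (closedBall x r) = ENNReal.ofReal (unitBallVolume d * r ^ d) :=
    fun r hr => by
      rw [volume_closedBall_eq_unitBallVolume x hr, ENNReal.ofReal_mul hω.le,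
        ENNReal.ofReal_pow hr]
  have hpos : volume (closedBall x R) ≠ 0 := (measure_closedBall_pos _ _ hR0).ne'
  rw [ENNReal.le_div_iff_mul_le (Or.inl hpos) (Or.inl measure_closedBall_lt_top.ne)]
  have hMne : (M : ℝ≥0∞) ≠ 0 := by exact_mod_cast hM
  refine (ENNReal.mul_le_mul_iff_right hMne (ENNReal.natCast_ne_top M)).1 ?_
  have hfin : ENNReal.ofReal C * (ENNReal.ofReal A * volume (closedBall x (R + a))) ≠ ∞ :=
    ENNReal.mul_ne_top ENNReal.ofReal_ne_top
      (ENNReal.mul_ne_top ENNReal.ofReal_ne_top measure_closedBall_lt_top.ne)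
  refine (ENNReal.add_le_add_iff_right hfin).1 (le_trans ?_ (h x R))
  rw [hV _ hRa1, hV _ hRa2, hV _ hR0.le, ← ENNReal.ofReal_natCast, ← ENNReal.ofReal_mul hb0,
    ← ENNReal.ofReal_mul hM0.le, ← ENNReal.ofReal_mul hA, ← ENNReal.ofReal_mul hC,
    ← ENNReal.ofReal_mul hA, ← ENNReal.ofReal_mul hM0.le,
    ← ENNReal.ofReal_add (by positivity) (by positivity)]
  refine ENNReal.ofReal_le_ofReal ?_
  have := mul_le_mul_of_nonneg_left hreal hω.le
  linarith

/-! ### The construction assembled. -/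

theorem theorem2 (d : ℕ) (hd : 2 ≤ d) (δ : ℝ) (hδ : 0 < δ) :
    ∃ f : EuclideanSpace ℝ (Fin d) → ℂ,
      Continuous f ∧ f 0 = 1 ∧ eLpNorm f ∞ volume = 1 ∧
      MemPaleyWienerInfty (closedBall 0 1) f ∧
      ∃ (φ : ℝ → ℝ) (Γ : Set (EuclideanSpace ℝ (Fin d))),
        φ 0 = 1 ∧ IsPhiRegular φ Γ ∧ Γ ⊆ {x | f x = 0} ∧
        ((2 * ((d : ℝ) / 2 * (unitBallVolume d / unitBallVolume (d - 1)) - δ) : ℝ) : EReal) <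
          (lowerSurfaceDensity Γ : EReal) := by
  obtain ⟨n, rfl⟩ : ∃ n, d = n + 1 := ⟨d - 1, by omega⟩
  have hn : n ≠ 0 := by omega
  rw [Nat.add_sub_cancel]
  set A := ((n + 1 : ℕ) : ℝ) / 2 * (unitBallVolume (n + 1) / unitBallVolume n) with hA
  obtain ⟨s, h0, hpar, hs, hsum⟩ := exists_zonotope hn (a := A - δ) (by
    rw [hA]
    push_cast
    linarith)
  obtain ⟨a, ha⟩ := exists_gridUnion_lower_bound s h0 hpar
  -- The room between `2 * (A - δ)` and `2 ∑ ‖w‖` pays for the fraction `s.card / M` lost near the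
  -- crossings, and keeps the final inequality strict.
  obtain ⟨b, hAb, hbs⟩ := exists_between (mul_lt_mul_of_pos_left hsum two_pos)
  rw [Finset.mul_sum] at hbs
  obtain ⟨M, hM0, hM⟩ : ∃ M : ℕ, M ≠ 0 ∧ M * b < (M - s.card) * ∑ w ∈ s, 2 * ‖w‖ := by
    obtain ⟨M, hM⟩ := exists_nat_gt
      ((s.card * ∑ w ∈ s, 2 * ‖w‖) / (∑ w ∈ s, 2 * ‖w‖ - b))
    have hpos : 0 < ∑ w ∈ s, 2 * ‖w‖ - b := sub_pos.2 hbs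
    have hM0 : (0 : ℝ) < M := lt_of_le_of_lt (by positivity) hM
    rw [div_lt_iff₀ hpos] at hM
    exact ⟨M, by exact_mod_cast hM0.ne', by linarith⟩
  obtain ⟨η, hη, hbound⟩ := ha M
  obtain ⟨τ, hτ, hloc⟩ := exists_gridUnion_inter_closedBall_subset s hη
  obtain ⟨φ, hφ, hreg⟩ := exists_isPhiRegular (isClosed_gridUnion s η) hτ fun x r hr => by
    by_cases hne : (gridUnion s η ∩ closedBall x r).Nonempty
    · obtain ⟨w, hw, c, hc, -⟩ := hloc x r hr hne
      exact ⟨w, h0 w hw, c, hc⟩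
    · exact ⟨EuclideanSpace.single 0 1, by simp, 0, fun y hy => (hne ⟨y, hy⟩).elim⟩
  refine ⟨cosProd s, continuous_cosProd s, cosProd_zero s, eLpNorm_cosProd s,
    memPaleyWienerInfty_cosProd s hs, φ, gridUnion s η, hφ, hreg, gridUnion_subset_zeros s η, ?_⟩
  have hD : ENNReal.ofReal b ≤ lowerSurfaceDensity (gridUnion s η) :=
    le_lowerSurfaceDensity hM0 (by positivity) (Nat.cast_nonneg s.card) hM fun x R => by
      rw [ENNReal.ofReal_natCast]
      exact hbound x R
  -- For large `δ` the bound may be negative, hence the comparison in `EReal` and the truncation `b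
  -- ≤ max b 0`.
  calc ((2 * (A - δ) : ℝ) : EReal) < (b : EReal) := EReal.coe_lt_coe_iff.2 hAb
    _ ≤ ((ENNReal.ofReal b : ℝ≥0∞) : EReal) := by
        rw [EReal.coe_ennreal_ofReal]
        exact EReal.coe_le_coe_iff.2 (le_max_left _ _)
    _ ≤ _ := EReal.coe_ennreal_le_coe_ennreal_iff.2 hD
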